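/- Let $d\ge 1$, let $a<b$ be integers, $\Lambda=\mathbb Z^d\cap[a,b]^d$, $\lambda>0$, and let $k=(k_x)_{x\in\Lambda}$ be real. On $L^2(\mathbb R^\Lambda)$, with position operators $q_x$ and momentum operators $p_x=-i\,\partial/\partial q_x$ (all polynomials in them acting on Schwartz functions), let $$H_\Lambda=\sum_{x\in\Lambda}(p_x^2+k_xq_x^2)+\sum_{\{x,y\}\subset\Lambda,\ |x-y|_1=1}\lambda(q_x-q_y)^2 ,$$ and let $h=\lambda h_0+\mathrm{diag}(k)$, where $(h_0\varphi)_x=\sum_{y\in\Lambda,\,|x-y|_1=1}(\varphi_x-\varphi_y)$. Put $a_x=\frac1{\sqrt2}(q_x+ip_x)$, $a_x^*=\frac1{\sqrt2}(q_x-ip_x)$. For $f:\Lambda\to\mathbb C$ let $\mathcal W(f)=\exp\big(\frac{i}{\sqrt2}(a(f)+a^*(f))\big)$ be the Weyl operator, where $a(f)=\sum_x\overline{f_x}a_x$ and $a^*(f)=\sum_xf_xa_x^*$; that is, $\mathcal W(f)=U(1)$ for a strongly continuous one-parameter unitary group $U$ on $L^2(\mathbb R^\Lambda)$ with $\frac{d}{dt}U(t)u\big|_{t=0}=\frac{i}{\sqrt2}(a(f)+a^*(f))u$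 for every Schwartz function $u$. Let $\tilde f=(\mathrm{Re} f,\mathrm{Im} f)\in\mathbb R^\Lambda\oplus\mathbb R^\Lambda$. (i) If the $k_x$ are i.i.d. with a distribution that has a bounded density and is supported in $[0,k_{\max}]$, then $h$ is almost surely positive definite. (ii) For every $f$ the unitary operator $\mathcal W(f)$ exists and is unique. (iii) Suppose that $h$ is positive definite, and let $h=\mathcal O\gamma^2\mathcal O^T$ be any diagonalization with $\mathcal O$ real orthogonal and $\gamma=\mathrm{diag}(\gamma_j)$, $\gamma_j>0$, the modes $j$ being labelled by $\Lambda$. Let $$b=\tfrac12(\gamma^{1/2}+\gamma^{-1/2})\mathcal O^Ta+\tfrac12(\gamma^{1/2}-\gamma^{-1/2})\mathcal O^Ta^*,$$ and let $b_j^*$ be the formal adjoint of $b_j$. There is a Schwartz function $\psi_0$ of $L^2$-norm $1$ with $b_j\psi_0=0$ for all $j$, and it is unique up to a phase. For $\alpha\in\mathbb N_0^\Lambda$ let $\psi_\alpha=\prod_j(\alpha_j!)^{-1/2}(b_j^*)^{\alpha_j}\psi_0$. Then $\|\psi_\alpha\|=1$ and $H_\Lambda\psi_\alpha=\big(\sum_j\gamma_j(2\alpha_j+1)\big)\psi_\alpha$,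 and for all $f:\Lambda\to\mathbb C$ $$\langle\psi_\alpha,\mathcal W(f)\psi_\alpha\rangle=e^{-\frac14\langle\tilde f,M\tilde f\rangle}\prod_{j\in\Lambda}L_{\alpha_j}\!\left(\frac{\langle\tilde f,M\chi_j(M)\tilde f\rangle}{2}\right),$$ where $$M=\begin{pmatrix}h^{-1/2}&0\\0&h^{1/2}\end{pmatrix},\qquad \chi_j(M)=\begin{pmatrix}\mathcal Oe_je_j^T\mathcal O^T&0\\0&\mathcal Oe_je_j^T\mathcal O^T\end{pmatrix},\qquad L_n(x)=\sum_{m=0}^n\frac{(-1)^mx^m}{m!}\binom nm .$$ Moreover, $\psi_0$ is the only Gaussian one among the eigenstates $\psi_\alpha$: writing $R=(q,p)$ and $\Gamma_{\alpha}=\big(\langle\psi_\alpha,R_iR_j\psi_\alpha\rangle\big)_{i,j}$, each of the following two conditions holds if and only if $\alpha=0$: (a) the first moments $\langle\psi_\alpha,R_i\psi_\alpha\rangle$ vanish and all moments of the $R_i$ in $\psi_\alpha$ obey the bosonic Wick theorem (each moment is the sum over all pairings of its factors of the products of the two-point functions); (b) $\langle\psi_\alpha,\mathcal W(f)\psi_\alpha\rangle=e^{-\frac12\langle\tilde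 f,\Gamma_{\alpha}\tilde f\rangle}$ for all $f$. -/

import Mathlib

open MeasureTheory
open scoped SchwartzMap LineDeriv MatrixOrder

noncomputable section

namespace Oscillator

/-! ### The box and the one-particle matrix -/

/-- The box `ℤ^d ∩ [a,b]^d`. -/
abbrev Box (d : ℕ) (a b : ℤ) : Type :=
  ↥(Finset.Icc (fun _ : Fin d => a) (fun _ : Fin d => b))

/-- The nearest neighbour graph of the box: `x` and `y` are adjacent when their `ℓ¹`-distance
is `1`. -/
def boxGraph (d : ℕ) (a b : ℤ) : SimpleGraph (Box d a b) where
  Adj x y := ∑ i, |x.1 i - y.1 i| = 1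
  symm := ⟨fun x y h => by simpa only [abs_sub_comm] using h⟩
  loopless := ⟨fun x h => by simp at h⟩

instance (d : ℕ) (a b : ℤ) : DecidableRel (boxGraph d a b).Adj := fun x y =>
  inferInstanceAs (Decidable (∑ i, |x.1 i - y.1 i| = 1))

section Matrices

variable {ι : Type} [Fintype ι] [DecidableEq ι]

/-- The finite volume Anderson matrix `h = lam • h₀ + diag k`, where `h₀` is the negative discrete
Laplacian of the graph `G`: `(h₀ φ) x = ∑_{y ~ x} (φ x - φ y)`. -/
def andersonMatrix (G : SimpleGraph ι) [DecidableRel G.Adj] (lam : ℝ) (k : ι → ℝ) :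
    Matrix ι ι ℝ :=
  lam • G.lapMatrix ℝ + Matrix.diagonal k

/-- `h = O diag(γ²) Oᵀ` with `O` real orthogonal and all `γ k` positive. The modes are labelled
by the same finite set as the sites. -/
def IsDiagonalization (h O : Matrix ι ι ℝ) (γ : ι → ℝ) : Prop :=
  O ∈ Matrix.orthogonalGroup ι ℝ ∧ (∀ k, 0 < γ k) ∧
    h = O * Matrix.diagonal (fun k => γ k ^ 2) * O.transpose

/-- `M = diag(h^{-1/2}, h^{1/2})`. -/
def corrMatrix (h : Matrix ι ι ℝ) : Matrix (ι ⊕ ι) (ι ⊕ ι) ℝ :=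
  Matrix.fromBlocks (CFC.sqrt h)⁻¹ 0 0 (CFC.sqrt h)

/-- The projection `χ_k(M)` onto the span of the eigenvectors `O e_k ⊕ 0` and `0 ⊕ O e_k` of `M`,
whose eigenvalues are `1 / γ k` and `γ k`. -/
def spectralProj (O : Matrix ι ι ℝ) (k : ι) : Matrix (ι ⊕ ι) (ι ⊕ ι) ℝ :=
  Matrix.fromBlocks O 0 0 O *
    Matrix.fromBlocks (Matrix.single k k 1) 0 0 (Matrix.single k k 1) *
    Matrix.fromBlocks O.transpose 0 0 O.transpose

/-- The real vector `(Re f, Im f)`. -/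
def tilde (f : ι → ℂ) : ι ⊕ ι → ℝ :=
  Sum.elim (fun x => (f x).re) (fun x => (f x).im)

end Matrices

/-- The Laguerre polynomial `L_n`. -/
def laguerre (n : ℕ) (x : ℝ) : ℝ :=
  ∑ j ∈ Finset.range (n + 1), (-1) ^ j * x ^ j / (j.factorial : ℝ) * (n.choose j : ℝ)

/-! ### Operators on `L²(ℝ^ι)` -/

/-- Configuration space `ℝ^ι`. -/
abbrev Conf (ι : Type) [Fintype ι] : Type := EuclideanSpace ℝ ι

/-- The Hilbert space `L²(ℝ^ι)`, with respect to Lebesgue measure. -/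
abbrev Hilb (ι : Type) [Fintype ι] : Type := Lp ℂ 2 (volume : Measure (Conf ι))

/-- Linear operators on the Schwartz space of `ℝ^ι`, the common invariant dense domain on which
all polynomials in the position and momentum operators are considered. -/
abbrev SOp (ι : Type) [Fintype ι] : Type := Module.End ℂ 𝓢(Conf ι, ℂ)

/-- A Schwartz function as an element of `L²(ℝ^ι)`. -/
abbrev toHilb {ι : Type} [Fintype ι] (u : 𝓢(Conf ι, ℂ)) : Hilb ι := u.toLp 2 volume

section Operators

variable {ι : Type} [Fintype ι] [DecidableEq ι]

/-- The position operator: multiplication by the coordinate `q_x`. -/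
def pos (x : ι) : SOp ι :=
  (SchwartzMap.smulLeftCLM (E := Conf ι) ℂ (fun q : Conf ι => ((q x : ℝ) : ℂ))).toLinearMap

/-- The momentum operator `-i ∂/∂q_x`. -/
def mom (x : ι) : SOp ι :=
  (-Complex.I) •
    (LineDeriv.lineDerivOpCLM ℂ 𝓢(Conf ι, ℂ) (EuclideanSpace.single x (1 : ℝ))).toLinearMap

/-- The annihilation operator `a_x = (q_x + i p_x) / √2`. -/
def ann (x : ι) : SOp ι := ((1 / Real.sqrt 2 : ℝ) : ℂ) • (pos x + Complex.I • mom x)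

/-- The creation operator `a_x^* = (q_x - i p_x) / √2`. -/
def cre (x : ι) : SOp ι := ((1 / Real.sqrt 2 : ℝ) : ℂ) • (pos x - Complex.I • mom x)

/-- The oscillator Hamiltonian
`∑ₓ (p_x² + k_x q_x²) + ∑_{{x,y} edge} lam (q_x - q_y)²`. The last sum is written over ordered
pairs, in which every edge occurs twice. -/
def hamiltonian (G : SimpleGraph ι) [DecidableRel G.Adj] (lam : ℝ) (k : ι → ℝ) : SOp ι :=
  ∑ x, (mom x ^ 2 + (k x : ℂ) • pos x ^ 2) +
    (1 / 2 : ℂ) • ∑ x, ∑ y, if G.Adj x y then (lam : ℂ) • (pos x - pos y) ^ 2 else 0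

/-- The field operator `(a(f) + a^*(f)) / √2`, with `a(f) = ∑ₓ conj (f x) a_x` and
`a^*(f) = ∑ₓ f x a_x^*`. -/
def field (f : ι → ℂ) : SOp ι :=
  ((1 / Real.sqrt 2 : ℝ) : ℂ) •
    (∑ x, (starRingEnd ℂ) (f x) • ann x + ∑ x, f x • cre x)

/-- `W = exp(iA)` for an operator `A` on the Schwartz space: `W` is the time-one operator of a
strongly continuous one-parameter unitary group `U` whose derivative at time zero is `iA` on
Schwartz functions (for essentially self-adjoint `A`, `U t = exp(i t A)` in the sense of
Stone's theorem for the closure of `A`). -/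
def IsUnitaryExp (A : SOp ι) (W : Hilb ι ≃ₗᵢ[ℂ] Hilb ι) : Prop :=
  ∃ U : ℝ → (Hilb ι ≃ₗᵢ[ℂ] Hilb ι),
    (∀ s t, U (s + t) = U s * U t) ∧
    (∀ φ : Hilb ι, Continuous fun t => U t φ) ∧
    (∀ u : 𝓢(Conf ι, ℂ), HasDerivAt (fun t => U t (toHilb u)) (Complex.I • toHilb (A u)) 0) ∧
    U 1 = W

/-- `W` is the Weyl operator `exp((i/√2) (a(f) + a^*(f)))`. -/
def IsWeyl (f : ι → ℂ) (W : Hilb ι ≃ₗᵢ[ℂ] Hilb ι) : Prop := IsUnitaryExp (field f) W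

/-! ### Bogoliubov modes and eigenstates -/

/-- The Bogoliubov annihilation operator
`b = ½ (γ^{1/2} + γ^{-1/2}) Oᵀ a + ½ (γ^{1/2} - γ^{-1/2}) Oᵀ a^*`. -/
def modeAnn (O : Matrix ι ι ℝ) (γ : ι → ℝ) (k : ι) : SOp ι :=
  (((Real.sqrt (γ k) + (Real.sqrt (γ k))⁻¹) / 2 : ℝ) : ℂ) • ∑ x, (O x k : ℂ) • ann x +
  (((Real.sqrt (γ k) - (Real.sqrt (γ k))⁻¹) / 2 : ℝ) : ℂ) • ∑ x, (O x k : ℂ) • cre x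

/-- The Bogoliubov creation operator `b_k^*`, the formal adjoint of `b_k`. -/
def modeCre (O : Matrix ι ι ℝ) (γ : ι → ℝ) (k : ι) : SOp ι :=
  (((Real.sqrt (γ k) + (Real.sqrt (γ k))⁻¹) / 2 : ℝ) : ℂ) • ∑ x, (O x k : ℂ) • cre x +
  (((Real.sqrt (γ k) - (Real.sqrt (γ k))⁻¹) / 2 : ℝ) : ℂ) • ∑ x, (O x k : ℂ) • ann x

/-- `ψ₀` is a normalized vacuum vector of the operators `b_k`. -/
def IsVacuum (O : Matrix ι ι ℝ) (γ : ι → ℝ) (ψ₀ : 𝓢(Conf ι, ℂ)) : Prop :=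
  ‖toHilb ψ₀‖ = 1 ∧ ∀ k, modeAnn O γ k ψ₀ = 0

/-- The Fock state `ψ_α = ∏ₖ (α_k!)^{-1/2} (b_k^*)^{α_k} ψ₀`. The creation operators commute, so
the order in which the product is taken does not matter. -/
def fockState (O : Matrix ι ι ℝ) (γ : ι → ℝ) (ψ₀ : 𝓢(Conf ι, ℂ)) (α : ι → ℕ) : 𝓢(Conf ι, ℂ) :=
  ((∏ k, (Real.sqrt ((α k).factorial : ℝ))⁻¹ : ℝ) : ℂ) •
    ((Finset.univ.toList.map fun k => modeCre O γ k ^ α k).prod ψ₀)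

/-! ### Expectations and Gaussian states -/

/-- The expectation `⟨ψ, W ψ⟩ = Tr(W |ψ⟩⟨ψ|)` of a unitary operator in the state `|ψ⟩⟨ψ|`. -/
def unitaryExpect (ψ : 𝓢(Conf ι, ℂ)) (W : Hilb ι ≃ₗᵢ[ℂ] Hilb ι) : ℂ :=
  inner ℂ (toHilb ψ) (W (toHilb ψ))

/-- The expectation `⟨ψ, X ψ⟩` of an operator `X` on the Schwartz space. -/
def expect (ψ : 𝓢(Conf ι, ℂ)) (X : SOp ι) : ℂ := inner ℂ (toHilb ψ) (toHilb (X ψ))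

/-- The vector `R = (q, p)` of position and momentum operators. -/
def phaseOp : ι ⊕ ι → SOp ι := Sum.elim pos mom

/-- The real linear combination `∑ᵢ v_i R_i`. -/
def phaseComb (v : ι ⊕ ι → ℝ) : SOp ι := ∑ i, (v i : ℂ) • phaseOp i

/-- The correlation matrix `⟨R_i R_j⟩`. -/
def stateCorr (ψ : 𝓢(Conf ι, ℂ)) : Matrix (ι ⊕ ι) (ι ⊕ ι) ℂ :=
  fun i j => expect ψ (phaseOp i * phaseOp j)

/-- The state `|ψ⟩⟨ψ|` is Gaussian (quasi-free) with vanishing first moments: the first moments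
of `q` and `p` vanish and the bosonic Wick theorem holds, i.e. the expectation of a product of real
linear combinations of positions and momenta is the sum over all pairings of the factors of the
products of the two-point functions of the pairs. The sum over pairings is
expanded according to the partner of the first factor; iterating reduces every moment to
two-point functions. -/
def IsGaussian (ψ : 𝓢(Conf ι, ℂ)) : Prop :=
  (∀ i, expect ψ (phaseOp i) = 0) ∧
  ∀ (v : ι ⊕ ι → ℝ) (l : List (ι ⊕ ι → ℝ)),
    expect ψ (phaseComb v * (l.map phaseComb).prod) =
      ∑ j : Fin l.length, expect ψ (phaseComb v * phaseComb (l.get j)) *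
        expect ψ (((l.eraseIdx j).map phaseComb).prod)

/-- The state `|ψ⟩⟨ψ|` has the characteristic function
`⟨W(f)⟩ = exp(-½ ⟨f̃, Γ f̃⟩)`, `Γ` being its correlation matrix. -/
def HasGaussianCharFun (ψ : 𝓢(Conf ι, ℂ)) : Prop :=
  ∀ (f : ι → ℂ) (W : Hilb ι ≃ₗᵢ[ℂ] Hilb ι), IsWeyl f W →
    unitaryExpect ψ W =
      Complex.exp (-(1 / 2) * ∑ i, ∑ j, (tilde f i : ℂ) * stateCorr ψ i j * (tilde f j : ℂ))

end Operators

/-! ### The disorder -/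

/-- The single-site distribution: a probability measure with bounded density, carried by
`[0, kmax]`. -/
def IsDisorderLaw (μ : Measure ℝ) (kmax : ℝ) : Prop :=
  IsProbabilityMeasure μ ∧ μ (Set.Icc 0 kmax)ᶜ = 0 ∧
    ∃ (ρ : ℝ → NNReal) (C : NNReal), Measurable ρ ∧ (∀ t, ρ t ≤ C) ∧
      μ = volume.withDensity (fun t => (ρ t : ENNReal))

end Oscillator

end

noncomputable section

namespace Oscillator

/-! ### Schwartz functions inside `L²` and formal adjoints -/

section FormalAdjoint

variable {ι : Type} [Fintype ι]

/-! Everything is computed in the algebra of operators on Schwartz space, where the combinations `∑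
(c x q_x + d x p_x)` have scalar commutators (`lin_mul_lin`). Orthogonality of `O` gives the modes
`b_j`, `b_j^*` the canonical commutation relations, and diagonalizing the quadratic form of the
potential turns the Hamiltonian into `∑ γ_j (2 b_j^* b_j + 1)` (`hamiltonian_eq_sum_modes`). Up to a
factor, `b_j` is `γ_j (Oᵀq)_j` plus the derivative along the column `O e_j`, so the vacuum equations
form a first order system whose only solutions are multiples of `exp (-½ ∑ γ_j (Oᵀq)_j²)`.

The Weyl operator is explicit: a translation times a phase (`weylS`). It preserves Schwartz space
and the `L²` norm, hence extends to a unitary group; any other group `V` with the same derivative at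
time zero agrees with it because `V(-t) S(t) w` is constant in `t`.

Let `z_j` be the coefficient of `b_j^*` in the field operator (`modeCoeff`). Then `b_j W = W b_j + i
z_j W` and `W b_j^* = b_j^* W + i conj(z_j) W`. The vacuum functional vanishes on operators that end
in some `b_j` or begin with some `b_j^*`; normal ordering therefore yields a factor `n! L_n(|z_j|²)`
for each mode (`map_ann_prod_mul_mul_cre_prod`), times the vacuum value of `W`. Along the group that
value solves `g' = -t κ g` with `κ = ∑ |z_j|²`, so it is `exp (-κ/2)` at time one. The matrix `M`
enters through `⟨f̃, M f̃⟩ = 2κ`, and `χ_j(M)` isolates the summand `|z_j|²`.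

The vacuum obeys Wick's theorem since only the annihilation part of the first factor acts, and its
commutators with the other factors are the two-point functions. In an excited state with `α_j = n ≥
1`, the quadrature `b_j + b_j^*` has second moment `2n+1` and fourth moment `6n²+6n+3 ≠ 3(2n+1)²`,
and a Gaussian characteristic function would force `L_n(x) = e^{-nx}` for all `x ≥ 0`. Finally, `h`
is almost surely positive definite because the Laplacian is positive semidefinite and a law with a
density has no atom at `0`. -/

theorem hasTemperateGrowth_coord (x : ι) :
    (fun q : Conf ι => ((q x : ℝ) : ℂ)).HasTemperateGrowth :=
  (Complex.ofRealCLM.comp (EuclideanSpace.proj (𝕜 := ℝ) x)).hasTemperateGrowth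

/-- The embedding of the Schwartz space into `L²` as a linear map. -/
def embed : 𝓢(Conf ι, ℂ) →ₗ[ℂ] Hilb ι :=
  (SchwartzMap.toLpCLM ℂ ℂ 2 (volume : Measure (Conf ι))).toLinearMap

theorem embed_apply (u : 𝓢(Conf ι, ℂ)) : embed u = toHilb u := rfl

theorem embed_injective : Function.Injective (embed (ι := ι)) :=
  SchwartzMap.injective_toLp 2 volume

theorem denseRange_embed : DenseRange (embed (ι := ι)) :=
  SchwartzMap.denseRange_toLpCLM (by norm_num)

theorem inner_embed (u v : 𝓢(Conf ι, ℂ)) :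
    inner ℂ (embed u) (embed v) = ∫ q, (starRingEnd ℂ) (u q) * v q := by
  rw [embed_apply, embed_apply]
  refine (SchwartzMap.inner_toL2_toL2_eq u v).trans ?_
  refine integral_congr_ae (Filter.Eventually.of_forall fun q => ?_)
  simp [mul_comm]

/-- `B` is the formal adjoint of `A` on the Schwartz space. -/
def IsFormalAdjoint (A B : SOp ι) : Prop :=
  ∀ u v, inner ℂ (embed (A u)) (embed v) = inner ℂ (embed u) (embed (B v))

namespace IsFormalAdjoint

variable {A B A' B' : SOp ι}

theorem symm (h : IsFormalAdjoint A B) : IsFormalAdjoint B A := fun u v => by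
  rw [← inner_conj_symm, ← h v u, inner_conj_symm]

theorem one : IsFormalAdjoint (1 : SOp ι) 1 := fun _ _ => rfl

theorem add (h : IsFormalAdjoint A B) (h' : IsFormalAdjoint A' B') :
    IsFormalAdjoint (A + A') (B + B') := fun u v => by
  simp only [LinearMap.add_apply, map_add, inner_add_left, inner_add_right, h u v, h' u v]

theorem smul (c : ℂ) (h : IsFormalAdjoint A B) :
    IsFormalAdjoint (c • A) ((starRingEnd ℂ) c • B) := fun u v => by
  simp only [LinearMap.smul_apply, map_smul, inner_smul_left, inner_smul_right, h u v]

theorem mul (h : IsFormalAdjoint A B) (h' : IsFormalAdjoint A' B') :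
    IsFormalAdjoint (A * A') (B' * B) := fun u v => by
  simp only [Module.End.mul_apply, h (A' u) v, h' u (B v)]

theorem pow (h : IsFormalAdjoint A B) (n : ℕ) : IsFormalAdjoint (A ^ n) (B ^ n) := by
  induction n with
  | zero => simpa using one
  | succ n ih => rw [pow_succ, pow_succ']; exact ih.mul h

theorem sum {κ : Type} {s : Finset κ} {A B : κ → SOp ι} (h : ∀ k, IsFormalAdjoint (A k) (B k)) :
    IsFormalAdjoint (∑ k ∈ s, A k) (∑ k ∈ s, B k) := fun u v => by
  simp only [LinearMap.sum_apply, map_sum, sum_inner, inner_sum, h _ u v]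

end IsFormalAdjoint

/-- Pointwise complex conjugation of Schwartz functions. -/
def conjS (u : 𝓢(Conf ι, ℂ)) : 𝓢(Conf ι, ℂ) :=
  SchwartzMap.postcompCLM (𝕜 := ℝ) Complex.conjCLE.toContinuousLinearMap u

@[simp]
theorem conjS_apply (u : 𝓢(Conf ι, ℂ)) (q : Conf ι) : conjS u q = (starRingEnd ℂ) (u q) := rfl

theorem fderiv_conjS (u : 𝓢(Conf ι, ℂ)) (q w : Conf ι) :
    fderiv ℝ (conjS u) q w = (starRingEnd ℂ) (fderiv ℝ u q w) := by
  have h : HasFDerivAt (conjS u)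
      (Complex.conjCLE.toContinuousLinearMap.comp (fderiv ℝ u q)) q :=
    (Complex.conjCLE.toContinuousLinearMap.hasFDerivAt).comp q (u.hasFDerivAt q)
  rw [h.fderiv]; rfl

end FormalAdjoint

/-! ### Canonical commutation relations of position and momentum -/

section SchwartzOperators

variable {ι : Type} [Fintype ι]

@[simp]
theorem pos_apply (x : ι) (u : 𝓢(Conf ι, ℂ)) (q : Conf ι) : pos x u q = (q x : ℂ) * u q :=
  SchwartzMap.smulLeftCLM_apply_apply (hasTemperateGrowth_coord x) u q

theorem isFormalAdjoint_pos (x : ι) : IsFormalAdjoint (pos x) (pos x) := fun u v => by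
  rw [inner_embed, inner_embed]
  congr 1; ext q
  simp only [pos_apply, map_mul, Complex.conj_ofReal]
  ring

theorem commute_pos (x y : ι) : pos x * pos y = pos y * pos x := by
  ext u q
  simp only [Module.End.mul_apply, pos_apply]
  ring

variable [DecidableEq ι]

@[simp]
theorem mom_apply (x : ι) (u : 𝓢(Conf ι, ℂ)) (q : Conf ι) :
    mom x u q = -Complex.I * fderiv ℝ u q (EuclideanSpace.single x 1) := rfl

/-- Integration by parts has no boundary term on Schwartz functions, and its minus sign is
compensated by conjugating the factor `-I`. -/
theorem isFormalAdjoint_mom (x : ι) : IsFormalAdjoint (mom x) (mom x) := fun u v => by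
  rw [inner_embed, inner_embed]
  have key := SchwartzMap.integral_mul_lineDerivOp_right_eq_neg_left (μ := volume) (conjS u) v
    (EuclideanSpace.single x (1 : ℝ))
  simp only [SchwartzMap.lineDerivOp_apply_eq_fderiv, conjS_apply, fderiv_conjS] at key
  have h1 : ∀ q, (starRingEnd ℂ) (mom x u q) * v q =
      Complex.I * ((starRingEnd ℂ) (fderiv ℝ u q (EuclideanSpace.single x 1)) * v q) := by
    intro q; simp [mul_assoc]
  have h2 : ∀ q, (starRingEnd ℂ) (u q) * mom x v q =
      -Complex.I * ((starRingEnd ℂ) (u q) * fderiv ℝ v q (EuclideanSpace.single x 1)) := by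
    intro q; simp; ring
  simp only [h1, h2]
  rw [integral_const_mul, integral_const_mul, key]
  ring

/-- Symmetry of the second derivative. -/
theorem commute_mom (x y : ι) : mom x * mom y = mom y * mom x := by
  ext u q
  have h : ∀ a b : ι, (mom a * mom b) u q = - iteratedFDeriv ℝ 2 u q
      ![EuclideanSpace.single a 1, EuclideanSpace.single b 1] := by
    intro a b
    rw [← SchwartzMap.iteratedLineDerivOp_eq_iteratedFDeriv, Module.End.mul_apply]
    have : mom b u = (-Complex.I) • ∂_{EuclideanSpace.single b (1 : ℝ)} u := rfl
    rw [this, map_smul]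
    simp only [smul_apply, mom_apply, smul_eq_mul,
      LineDeriv.iteratedLineDerivOp_succ_left,
      SchwartzMap.lineDerivOp_apply_eq_fderiv]
    rw [← mul_assoc]
    simp [Fin.tail]
  rw [h x y, h y x, iteratedFDeriv_two_apply, iteratedFDeriv_two_apply]
  congr 1
  have hs : IsSymmSndFDerivAt ℝ u q :=
    (u.contDiffAt 2).isSymmSndFDerivAt (by simp)
  exact hs _ _

theorem pos_mul_mom (x y : ι) :
    pos x * mom y = mom y * pos x + (if x = y then Complex.I else 0) • (1 : SOp ι) := by
  ext u q
  have h : HasFDerivAt (pos x u)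
      ((q x : ℂ) • fderiv ℝ u q +
        (Complex.ofRealCLM.comp (EuclideanSpace.proj (𝕜 := ℝ) x)).smulRight (u q)) q := by
    have h1 : HasFDerivAt (fun q : Conf ι => ((q x : ℝ) : ℂ))
        (Complex.ofRealCLM.comp (EuclideanSpace.proj (𝕜 := ℝ) x)) q :=
      (Complex.ofRealCLM.comp (EuclideanSpace.proj (𝕜 := ℝ) x)).hasFDerivAt
    have h2 := h1.smul (u.hasFDerivAt q)
    refine h2.congr_of_eventuallyEq (Filter.Eventually.of_forall fun q => ?_)
    simp
  simp only [Module.End.mul_apply, pos_apply, mom_apply, LinearMap.add_apply,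
    LinearMap.smul_apply, Module.End.one_apply, add_apply, smul_apply,
    h.fderiv]
  by_cases hxy : x = y
  · simp [hxy]; ring_nf
  · simp [hxy]; ring

end SchwartzOperators

/-! ### Linear combinations of `q` and `p`, and the Bogoliubov modes -/

section LinearCombinations

variable {ι : Type} [Fintype ι] [DecidableEq ι]

/-- The linear combination `∑ₓ (c x q_x + d x p_x)` with complex coefficients. -/
def lin (c d : ι → ℂ) : SOp ι := ∑ x, (c x • pos x + d x • mom x)

theorem lin_add (c d c' d' : ι → ℂ) : lin c d + lin c' d' = lin (c + c') (d + d') := by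
  simp only [lin, ← Finset.sum_add_distrib, Pi.add_apply, add_smul]
  exact Finset.sum_congr rfl fun x _ => by abel

theorem smul_lin (s : ℂ) (c d : ι → ℂ) : s • lin c d = lin (s • c) (s • d) := by
  simp only [lin, Finset.smul_sum, smul_add, smul_smul, Pi.smul_apply, smul_eq_mul]

theorem sum_lin {κ : Type} (s : Finset κ) (c d : κ → ι → ℂ) :
    ∑ k ∈ s, lin (c k) (d k) = lin (fun x => ∑ k ∈ s, c k x) (fun x => ∑ k ∈ s, d k x) := by
  simp only [lin]
  rw [Finset.sum_comm]
  simp only [Finset.sum_add_distrib, Finset.sum_smul]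

theorem lin_apply (c d : ι → ℂ) (u : 𝓢(Conf ι, ℂ)) (q : Conf ι) :
    lin c d u q = (∑ x, c x * q x) * u q +
      ∑ x, d x * (-Complex.I * fderiv ℝ u q (EuclideanSpace.single x 1)) := by
  simp only [lin, LinearMap.sum_apply, LinearMap.add_apply, LinearMap.smul_apply, sum_apply,
    add_apply, smul_apply, pos_apply, mom_apply, smul_eq_mul, Finset.sum_add_distrib,
    Finset.sum_mul, mul_assoc]

theorem isFormalAdjoint_lin (c d : ι → ℂ) :
    IsFormalAdjoint (lin c d) (lin (fun x => (starRingEnd ℂ) (c x))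
      (fun x => (starRingEnd ℂ) (d x))) :=
  .sum fun x => ((isFormalAdjoint_pos x).smul _).add ((isFormalAdjoint_mom x).smul _)

/-- The commutator of two linear combinations is `I` times the symplectic form of their
coefficients. All commutation relations of the modes are instances of this. -/
theorem lin_mul_lin (c d c' d' : ι → ℂ) :
    lin c d * lin c' d' = lin c' d' * lin c d +
      (Complex.I * ∑ x, (c x * d' x - d x * c' x)) • (1 : SOp ι) := by
  have h : ∀ x y, (c x • pos x + d x • mom x) * (c' y • pos y + d' y • mom y) =
      (c' y • pos y + d' y • mom y) * (c x • pos x + d x • mom x) +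
        (if x = y then Complex.I * (c x * d' x - d x * c' x) else 0) • (1 : SOp ι) := by
    intro x y
    have e1 := commute_pos x y
    have e2 := commute_mom x y
    have e3 := pos_mul_mom x y
    have e4 := pos_mul_mom y x
    simp only [add_mul, mul_add, smul_mul_smul_comm, e1, e2, e3, e4, smul_add, smul_smul]
    by_cases hxy : x = y
    · subst hxy; simp only [if_true]; module
    · simp only [hxy, Ne.symm hxy, if_false]; module
  have hl : lin c d * lin c' d' =
      ∑ x, ∑ y, (c x • pos x + d x • mom x) * (c' y • pos y + d' y • mom y) :=
    Finset.sum_mul_sum ..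
  have hr : lin c' d' * lin c d =
      ∑ x, ∑ y, (c' y • pos y + d' y • mom y) * (c x • pos x + d x • mom x) :=
    (Finset.sum_mul_sum ..).trans Finset.sum_comm
  rw [hl, hr, ← sub_eq_iff_eq_add', ← Finset.sum_sub_distrib, Finset.mul_sum, Finset.sum_smul]
  refine Finset.sum_congr rfl fun x _ => ?_
  rw [← Finset.sum_sub_distrib]
  simp [h]

theorem ann_eq_lin (x : ι) : ann x = lin (Pi.single x ((1 / Real.sqrt 2 : ℝ) : ℂ))
    (Pi.single x (((1 / Real.sqrt 2 : ℝ) : ℂ) * Complex.I)) := by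
  simp only [lin, Pi.single_apply, ite_smul, zero_smul, Finset.sum_add_distrib,
    Finset.sum_ite_eq', Finset.mem_univ, if_true, ann, smul_add, smul_smul]

theorem cre_eq_lin (x : ι) : cre x = lin (Pi.single x ((1 / Real.sqrt 2 : ℝ) : ℂ))
    (Pi.single x (-(((1 / Real.sqrt 2 : ℝ) : ℂ) * Complex.I))) := by
  simp only [lin, Pi.single_apply, ite_smul, zero_smul, Finset.sum_add_distrib,
    Finset.sum_ite_eq', Finset.mem_univ, if_true, cre, smul_sub, smul_smul, neg_smul]
  abel

theorem phaseComb_eq_lin (v : ι ⊕ ι → ℝ) :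
    phaseComb v = lin (fun x => (v (.inl x) : ℂ)) (fun x => (v (.inr x) : ℂ)) := by
  simp [phaseComb, lin, phaseOp, Fintype.sum_sum_type, Finset.sum_add_distrib]

/-- The prefactor `1/√2` and the one inside `a_x`, `a_x^*` multiply to `1/2`, which turns `f ± conj
f` into real and imaginary parts. So `tilde f` is the coefficient vector of the field operator. -/
theorem field_eq_lin (f : ι → ℂ) :
    field f = lin (fun x => ((f x).re : ℂ)) (fun x => ((f x).im : ℂ)) := by
  have h2 : (((1 / Real.sqrt 2 : ℝ) : ℂ)) * ((1 / Real.sqrt 2 : ℝ) : ℂ) = 1 / 2 := by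
    rw [← Complex.ofReal_mul, div_mul_div_comm, Real.mul_self_sqrt (by norm_num)]; norm_num
  simp only [field, ann_eq_lin, cre_eq_lin, smul_lin, sum_lin, lin_add]
  congr 1 <;> ext x
  · simp only [Pi.smul_apply, Pi.add_apply, Pi.single_apply, smul_eq_mul, mul_ite, mul_zero,
      Finset.sum_ite_eq, Finset.mem_univ, if_true]
    rw [Complex.re_eq_add_conj]
    linear_combination ((starRingEnd ℂ) (f x) + f x) * h2
  · simp only [Pi.smul_apply, Pi.add_apply, Pi.single_apply, smul_eq_mul, mul_ite, mul_zero,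
      Finset.sum_ite_eq, Finset.mem_univ, if_true]
    rw [Complex.im_eq_sub_conj]
    have hI : (f x - (starRingEnd ℂ) (f x)) / (2 * Complex.I) =
        - (f x - (starRingEnd ℂ) (f x)) * Complex.I / 2 := by
      field_simp; simp
    rw [hI]
    linear_combination ((starRingEnd ℂ) (f x) - f x) * Complex.I * h2

section Modes

variable (O : Matrix ι ι ℝ) (γ : ι → ℝ)

/-- In terms of `q` and `p` the half sum and half difference of `γ^{1/2}` and `γ^{-1/2}` recombine:
positions carry `γ^{1/2}` alone, momenta `γ^{-1/2}` alone. -/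
theorem modeAnn_eq_lin {γ : ι → ℝ} (j : ι) :
    modeAnn O γ j = lin (fun x => ((Real.sqrt (γ j) / Real.sqrt 2 * O x j : ℝ) : ℂ))
      (fun x => Complex.I * (((Real.sqrt (γ j))⁻¹ / Real.sqrt 2 * O x j : ℝ) : ℂ)) := by
  simp only [modeAnn, ann_eq_lin, cre_eq_lin, smul_lin, sum_lin, lin_add]
  congr 1 <;> ext x <;>
  · simp only [Pi.smul_apply, Pi.add_apply, Pi.single_apply, smul_eq_mul, mul_ite, mul_zero,
      Finset.sum_ite_eq, Finset.mem_univ, if_true]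
    push_cast
    ring

theorem modeCre_eq_lin {γ : ι → ℝ} (j : ι) :
    modeCre O γ j = lin (fun x => ((Real.sqrt (γ j) / Real.sqrt 2 * O x j : ℝ) : ℂ))
      (fun x => -Complex.I * (((Real.sqrt (γ j))⁻¹ / Real.sqrt 2 * O x j : ℝ) : ℂ)) := by
  simp only [modeCre, ann_eq_lin, cre_eq_lin, smul_lin, sum_lin, lin_add]
  congr 1 <;> ext x <;>
  · simp only [Pi.smul_apply, Pi.add_apply, Pi.single_apply, smul_eq_mul, mul_ite, mul_zero,
      Finset.sum_ite_eq, Finset.mem_univ, if_true]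
    push_cast
    ring

theorem isFormalAdjoint_modeAnn (j : ι) : IsFormalAdjoint (modeAnn O γ j) (modeCre O γ j) := by
  rw [modeAnn_eq_lin, modeCre_eq_lin]
  convert isFormalAdjoint_lin _ _ using 2 <;> ext x <;> simp

variable {O γ}

theorem orthogonal_sum_col (hO : O ∈ Matrix.orthogonalGroup ι ℝ) (j k : ι) :
    ∑ x, O x j * O x k = if j = k then 1 else 0 := by
  have h := congrFun (congrFun ((Matrix.mem_orthogonalGroup_iff' ι ℝ).1 hO) j) k
  simpa [Matrix.mul_apply, Matrix.one_apply] using h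

theorem orthogonal_sum_row (hO : O ∈ Matrix.orthogonalGroup ι ℝ) (x y : ι) :
    ∑ j, O x j * O y j = if x = y then 1 else 0 := by
  have h := congrFun (congrFun ((Matrix.mem_orthogonalGroup_iff ι ℝ).1 hO) x) y
  simpa [Matrix.mul_apply, Matrix.one_apply] using h

/-- The symplectic form is `√γ_j/√γ_k - √γ_k/√γ_j` times a product of columns of `O`: the first
factor vanishes for `j = k`, the second for `j ≠ k`. -/
theorem modeAnn_mul_modeAnn (hO : O ∈ Matrix.orthogonalGroup ι ℝ) (j k : ι) :
    modeAnn O γ j * modeAnn O γ k = modeAnn O γ k * modeAnn O γ j := by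
  rw [modeAnn_eq_lin, modeAnn_eq_lin, lin_mul_lin, add_eq_left]
  have h := orthogonal_sum_col hO j k
  have e : ∀ x, (((Real.sqrt (γ j) / Real.sqrt 2 * O x j : ℝ) : ℂ)) *
      (Complex.I * (((Real.sqrt (γ k))⁻¹ / Real.sqrt 2 * O x k : ℝ) : ℂ)) -
      (Complex.I * (((Real.sqrt (γ j))⁻¹ / Real.sqrt 2 * O x j : ℝ) : ℂ)) *
      ((Real.sqrt (γ k) / Real.sqrt 2 * O x k : ℝ) : ℂ) =
      Complex.I * (((Real.sqrt (γ j) * (Real.sqrt (γ k))⁻¹ - (Real.sqrt (γ j))⁻¹ * Real.sqrt (γ k))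
        / Real.sqrt 2 / Real.sqrt 2 * (O x j * O x k) : ℝ) : ℂ) := by
    intro x; push_cast; ring
  simp only [e, ← Finset.mul_sum, ← Complex.ofReal_sum, h]
  by_cases hjk : j = k
  · subst hjk
    simp [mul_comm]
  · simp [hjk]

theorem modeCre_mul_modeCre (hO : O ∈ Matrix.orthogonalGroup ι ℝ) (j k : ι) :
    modeCre O γ j * modeCre O γ k = modeCre O γ k * modeCre O γ j := by
  rw [modeCre_eq_lin, modeCre_eq_lin, lin_mul_lin, add_eq_left]
  have h := orthogonal_sum_col hO j k
  have e : ∀ x, (((Real.sqrt (γ j) / Real.sqrt 2 * O x j : ℝ) : ℂ)) *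
      (-Complex.I * (((Real.sqrt (γ k))⁻¹ / Real.sqrt 2 * O x k : ℝ) : ℂ)) -
      (-Complex.I * (((Real.sqrt (γ j))⁻¹ / Real.sqrt 2 * O x j : ℝ) : ℂ)) *
      ((Real.sqrt (γ k) / Real.sqrt 2 * O x k : ℝ) : ℂ) =
      -Complex.I * (((Real.sqrt (γ j) * (Real.sqrt (γ k))⁻¹ - (Real.sqrt (γ j))⁻¹ * Real.sqrt (γ k))
        / Real.sqrt 2 / Real.sqrt 2 * (O x j * O x k) : ℝ) : ℂ) := by
    intro x; push_cast; ring
  simp only [e, ← Finset.mul_sum, ← Complex.ofReal_sum, h]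
  by_cases hjk : j = k
  · subst hjk
    simp [mul_comm]
  · simp [hjk]

theorem modeAnn_mul_modeCre (hO : O ∈ Matrix.orthogonalGroup ι ℝ) (hγ : ∀ j, 0 < γ j) (j k : ι) :
    modeAnn O γ j * modeCre O γ k = modeCre O γ k * modeAnn O γ j + if j = k then 1 else 0 := by
  rw [modeAnn_eq_lin, modeCre_eq_lin, lin_mul_lin]
  congr 1
  have h := orthogonal_sum_col hO j k
  have e : ∀ x, (((Real.sqrt (γ j) / Real.sqrt 2 * O x j : ℝ) : ℂ)) *
      (-Complex.I * (((Real.sqrt (γ k))⁻¹ / Real.sqrt 2 * O x k : ℝ) : ℂ)) -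
      (Complex.I * (((Real.sqrt (γ j))⁻¹ / Real.sqrt 2 * O x j : ℝ) : ℂ)) *
      ((Real.sqrt (γ k) / Real.sqrt 2 * O x k : ℝ) : ℂ) =
      -Complex.I * (((Real.sqrt (γ j) * (Real.sqrt (γ k))⁻¹ + (Real.sqrt (γ j))⁻¹ * Real.sqrt (γ k))
        / (Real.sqrt 2 * Real.sqrt 2) * (O x j * O x k) : ℝ) : ℂ) := by
    intro x; push_cast; ring
  simp only [e, ← Finset.mul_sum, ← Complex.ofReal_sum, h]
  by_cases hjk : j = k
  · subst hjk
    have hs : Real.sqrt (γ j) ≠ 0 := (Real.sqrt_pos.2 (hγ j)).ne'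
    have : (Real.sqrt (γ j) * (Real.sqrt (γ j))⁻¹ + (Real.sqrt (γ j))⁻¹ * Real.sqrt (γ j))
        / (Real.sqrt 2 * Real.sqrt 2) = 1 := by
      rw [mul_inv_cancel₀ hs, inv_mul_cancel₀ hs, Real.mul_self_sqrt (by norm_num)]; norm_num
    rw [this]
    simp
  · simp [hjk]

/-- The coefficient of `b_j^*` in `∑ₓ (u x q_x + v x p_x)`. -/
def modeCoeff (O : Matrix ι ι ℝ) (γ u v : ι → ℝ) (j : ι) : ℂ :=
  (((Real.sqrt (γ j))⁻¹ / Real.sqrt 2 * ∑ x, O x j * u x : ℝ) : ℂ) +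
    Complex.I * ((Real.sqrt (γ j) / Real.sqrt 2 * ∑ x, O x j * v x : ℝ) : ℂ)

/-- Inversion of the Bogoliubov transformation, by completeness of the columns of `O`. For real
coefficients the field is formally self-adjoint, so those of `b_j` and `b_j^*` are conjugate. -/
theorem lin_eq_sum_modes (hO : O ∈ Matrix.orthogonalGroup ι ℝ) (hγ : ∀ j, 0 < γ j)
    (u v : ι → ℝ) :
    lin (fun x => (u x : ℂ)) (fun x => (v x : ℂ)) =
      ∑ j, ((starRingEnd ℂ) (modeCoeff O γ u v j) • modeAnn O γ j +
        modeCoeff O γ u v j • modeCre O γ j) := by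
  simp only [modeAnn_eq_lin, modeCre_eq_lin, smul_lin, lin_add, sum_lin]
  have h2 : Real.sqrt 2 * Real.sqrt 2 = 2 := Real.mul_self_sqrt (by norm_num)
  have h2' : Real.sqrt 2 ≠ 0 := by positivity
  have hs : ∀ j, Real.sqrt (γ j) ≠ 0 := fun j => (Real.sqrt_pos.2 (hγ j)).ne'
  have key : ∀ (w : ι → ℝ) (x : ι), ∑ j, (∑ y, O y j * w y) * O x j = w x := by
    intro w x
    simp only [Finset.sum_mul]
    rw [Finset.sum_comm]
    have : ∀ y, ∑ j, O y j * w y * O x j = w y * if y = x then 1 else 0 := by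
      intro y
      rw [← orthogonal_sum_row hO y x, Finset.mul_sum]
      exact Finset.sum_congr rfl fun j _ => by ring
    simp [this]
  congr 1 <;> ext x
  · rw [← key u x, Complex.ofReal_sum]
    refine Finset.sum_congr rfl fun j _ => ?_
    simp only [modeCoeff, Pi.add_apply, Pi.smul_apply, smul_eq_mul, map_add, map_mul,
      Complex.conj_ofReal, Complex.conj_I]
    -- The factor `2` counts the equal contributions of `b_j` and `b_j^*`.
    have e : (Real.sqrt (γ j))⁻¹ / Real.sqrt 2 * (∑ x, O x j * u x) *
        (Real.sqrt (γ j) / Real.sqrt 2 * O x j) * 2 = (∑ x, O x j * u x) * O x j := by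
      field_simp [hs j]
      rw [pow_two, h2]; ring
    rw [← e]
    push_cast
    ring
  · rw [← key v x, Complex.ofReal_sum]
    refine Finset.sum_congr rfl fun j _ => ?_
    simp only [modeCoeff, Pi.add_apply, Pi.smul_apply, smul_eq_mul, map_add, map_mul,
      Complex.conj_ofReal, Complex.conj_I]
    have e : Real.sqrt (γ j) / Real.sqrt 2 * (∑ x, O x j * v x) *
        ((Real.sqrt (γ j))⁻¹ / Real.sqrt 2 * O x j) * 2 = (∑ x, O x j * v x) * O x j := by
      field_simp [hs j]
      rw [pow_two, h2]; ring
    rw [← e]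
    push_cast
    ring_nf
    simp

end Modes

end LinearCombinations

/-! ### Laguerre polynomials -/

section Laguerre

theorem laguerre_zero_right (n : ℕ) : laguerre n 0 = 1 := by
  rw [laguerre, Finset.sum_range_succ']
  simp

theorem laguerre_zero_left (x : ℝ) : laguerre 0 x = 1 := by simp [laguerre]

/-- The defining sum read backwards, `k` being replaced by `n - k`. This is the shape in which
normal ordering produces it. -/
theorem factorial_mul_laguerre (n : ℕ) (r : ℝ) :
    (n.factorial : ℂ) * (laguerre n r : ℂ) =
      ∑ k ∈ Finset.range (n + 1), (n.choose k : ℂ) * n.descFactorial k * (-(r : ℂ)) ^ (n - k) := by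
  rw [laguerre, ← Finset.sum_range_reflect, Complex.ofReal_sum, Finset.mul_sum]
  refine Finset.sum_congr rfl fun k hk => ?_
  have hk' : k ≤ n := Nat.lt_succ_iff.1 (Finset.mem_range.1 hk)
  have h1 : n + 1 - 1 - k = n - k := by omega
  have h2 : ((n - k).factorial : ℂ) * n.descFactorial k = n.factorial := by
    exact_mod_cast Nat.factorial_mul_descFactorial hk'
  have h3 : ((n - k).factorial : ℂ) ≠ 0 := by exact_mod_cast Nat.factorial_ne_zero _
  rw [h1, Nat.choose_symm hk', ← h2, neg_pow (r : ℂ)]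
  push_cast
  field_simp

end Laguerre

/-! ### Algebra of ladder operators -/

section LadderAlgebra

variable {A : Type*} [Ring A]

theorem ann_mul_cre_pow {b c : A} (h : b * c = c * b + 1) (n : ℕ) :
    b * c ^ (n + 1) = c ^ (n + 1) * b + (n + 1 : ℕ) • c ^ n := by
  induction n with
  | zero => simp [h]
  | succ n ih =>
    rw [pow_succ c (n + 1), ← mul_assoc, ih, add_mul, mul_assoc _ b c, h, mul_add, ← mul_assoc,
      mul_one, smul_mul_assoc, ← pow_succ, ← pow_succ, add_assoc, succ_nsmul' _ (n + 1)]

variable [Algebra ℂ A]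

/-- The canonical commutation relations of a family of annihilation operators `b` and creation
operators `c`. -/
structure IsCCR {ι : Type} [DecidableEq ι] (b c : ι → A) : Prop where
  ann_comm : ∀ j k, b j * b k = b k * b j
  cre_comm : ∀ j k, c j * c k = c k * c j
  ann_cre : ∀ j k, b j * c k = c k * b j + if j = k then 1 else 0

section OneMode

variable {b c W : A}

/-- Here `ℓ` abstracts the vacuum functional. Each `b` moved to the right end is killed there,
leaving only its commutator with the remaining power of `c`; the exponents collected on the way form
the falling factorial. -/
theorem map_ann_pow_mul_cre_pow {ℓ : A →ₗ[ℂ] ℂ} (h : b * c = c * b + 1)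
    (hr : ∀ X, ℓ (X * b) = 0) (X : A) (k : ℕ) {n : ℕ} (hkn : k ≤ n) :
    ℓ (X * b ^ k * c ^ n) = n.descFactorial k * ℓ (X * c ^ (n - k)) := by
  induction k generalizing n with
  | zero => simp
  | succ k ih =>
    obtain ⟨m, rfl⟩ : ∃ m, n = m + 1 := ⟨n - 1, by omega⟩
    rw [pow_succ b k, ← mul_assoc, mul_assoc _ b, ann_mul_cre_pow h, mul_add, map_add, ← mul_assoc,
      hr, zero_add, mul_smul_comm, map_nsmul, ih (by omega), Nat.succ_descFactorial_succ,
      Nat.add_sub_add_right, nsmul_eq_mul]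
    push_cast
    ring

theorem map_mul_cre_pow {ℓ : A →ₗ[ℂ] ℂ} {e : ℂ} (hWc : W * c = c * W + e • W)
    (hl : ∀ X, ℓ (c * X) = 0) (m : ℕ) : ℓ (W * c ^ m) = e ^ m * ℓ W := by
  induction m with
  | zero => simp
  | succ m ih =>
    rw [pow_succ', ← mul_assoc, hWc, add_mul, map_add, mul_assoc, hl, zero_add, smul_mul_assoc,
      map_smul, ih, smul_eq_mul, pow_succ']
    ring

/-- The diagonal matrix elements of a Weyl operator in the number states of one mode are given by
Laguerre polynomials. -/
theorem map_ann_pow_mul_mul_cre_pow {ℓ : A →ₗ[ℂ] ℂ} {d e : ℂ} {r : ℝ} (h : b * c = c * b + 1)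
    (hr : ∀ X, ℓ (X * b) = 0) (hl : ∀ X, ℓ (c * X) = 0) (hbW : b * W = W * b + d • W)
    (hWc : W * c = c * W + e • W) (hde : d * e = -(r : ℂ)) (n : ℕ) :
    ℓ (b ^ n * W * c ^ n) = n.factorial * laguerre n r * ℓ W := by
  -- Since `b W = W (b + d)` with a central `d`, `b ^ n * W = W * (b + d) ^ n` expands binomially.
  have hs : SemiconjBy W (b + algebraMap ℂ A d) b := by
    rw [SemiconjBy, hbW, mul_add, Algebra.smul_def, Algebra.commutes]
  have h1 : b ^ n * W = ∑ k ∈ Finset.range (n + 1),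
      ((n.choose k : ℂ) * d ^ (n - k)) • (W * b ^ k) := by
    rw [← (hs.pow_right n).eq, Commute.add_pow (show Commute b _ from (Algebra.commutes d b).symm), Finset.mul_sum]
    refine Finset.sum_congr rfl fun k _ => ?_
    rw [← map_pow, ← map_natCast (algebraMap ℂ A), mul_assoc, ← map_mul, ← mul_assoc,
      ← Algebra.commutes, ← Algebra.smul_def, mul_comm]
  rw [h1, Finset.sum_mul, map_sum, factorial_mul_laguerre, Finset.sum_mul]
  refine Finset.sum_congr rfl fun k hk => ?_
  rw [smul_mul_assoc, map_smul,
    map_ann_pow_mul_cre_pow h hr _ k (Nat.lt_succ_iff.1 (Finset.mem_range.1 hk)),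
    map_mul_cre_pow hWc hl, ← hde, mul_pow, smul_eq_mul]
  ring

end OneMode

section ManyModes

variable {ι : Type} [DecidableEq ι] {b c : ι → A}

/-- Reversing the annihilators puts the head mode `j` next to `W` on both sides. The induction
absorbs it into `W`: `b_j^{α_j} W c_j^{α_j}` has the same commutators with the other modes as `W`,
because these commute with mode `j`. The remaining one-mode matrix element is a Laguerre polynomial.
-/
theorem map_ann_prod_mul_mul_cre_prod (h : IsCCR b c) {ℓ : A →ₗ[ℂ] ℂ}
    (hr : ∀ j X, ℓ (X * b j) = 0) (hl : ∀ j X, ℓ (c j * X) = 0) {d e : ι → ℂ} {r : ι → ℝ}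
    (hde : ∀ j, d j * e j = -(r j : ℂ)) (α : ι → ℕ) (l : List ι) (hn : l.Nodup) (W : A)
    (hbW : ∀ j ∈ l, b j * W = W * b j + d j • W) (hWc : ∀ j ∈ l, W * c j = c j * W + e j • W) :
    ℓ ((l.reverse.map fun j => b j ^ α j).prod * W * (l.map fun j => c j ^ α j).prod) =
      (l.map fun j => ((α j).factorial : ℂ) * laguerre (α j) (r j)).prod * ℓ W := by
  induction l generalizing W with
  | nil => simp
  | cons j l ih =>
    obtain ⟨hj, hn'⟩ := List.nodup_cons.1 hn
    have hne : ∀ k ∈ l, k ≠ j := fun k hk hkj => hj (hkj ▸ hk)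
    have hcb : ∀ k ∈ l, Commute (b k) (c j ^ α j) := fun k hk =>
      Commute.pow_right (by simpa [hne k hk] using! h.ann_cre k j) _
    have hbc : ∀ k ∈ l, Commute (b j ^ α j) (c k) := fun k hk =>
      Commute.pow_left (by simpa [(hne k hk).symm] using! h.ann_cre j k) _
    have hbb : ∀ k, Commute (b k) (b j ^ α j) := fun k => Commute.pow_right (h.ann_comm k j) _
    have hcc : ∀ k, Commute (c j ^ α j) (c k) := fun k => Commute.pow_left (h.cre_comm j k) _
    have key := ih hn' (b j ^ α j * W * c j ^ α j) (fun k hk => by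
        rw [← mul_assoc, ← mul_assoc, (hbb k).eq, mul_assoc _ (b k) W,
          hbW k (List.mem_cons_of_mem _ hk), mul_assoc _ (c j ^ α j) (b k), ← (hcb k hk).eq]
        simp only [mul_add, add_mul, mul_assoc, mul_smul_comm, smul_mul_assoc])
      (fun k hk => by
        rw [mul_assoc, (hcc k).eq, ← mul_assoc, mul_assoc _ W (c k),
          hWc k (List.mem_cons_of_mem _ hk), mul_add, ← mul_assoc, (hbc k hk).eq]
        simp only [add_mul, mul_assoc, mul_smul_comm, smul_mul_assoc])
    rw [map_ann_pow_mul_mul_cre_pow (by simpa using h.ann_cre j j) (hr j) (hl j)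
      (hbW j (by simp)) (hWc j (by simp)) (hde j)] at key
    simp only [List.reverse_cons, List.map_append, List.map_cons, List.map_nil, List.prod_append,
      List.prod_cons, List.prod_nil, mul_one]
    rw [mul_assoc, mul_assoc] at key ⊢
    rw [mul_assoc] at key
    simp only [mul_assoc] at key ⊢
    rw [key]
    ring

/-- The number operator `c_j b_j` commutes with the other modes and increases by `α_j` when it
passes `c_j ^ α_j`. -/
theorem number_mul_cre_prod (h : IsCCR b c) (α : ι → ℕ) (j : ι) (l : List ι) :
    c j * b j * (l.map fun k => c k ^ α k).prod =
      (l.map fun k => c k ^ α k).prod *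
        (c j * b j + ((l.map fun k => if k = j then α k else 0).sum : ℕ)) := by
  induction l with
  | nil => simp
  | cons k l ih =>
    have h1 : c j * b j * c k ^ α k = c k ^ α k * (c j * b j + (if k = j then α k else 0 : ℕ)) := by
      by_cases hkj : k = j
      · subst hkj
        rcases hα : α k with _ | n
        · simp
        · rw [mul_assoc, ann_mul_cre_pow (by simpa using h.ann_cre k k)]
          simp only [if_true, mul_add, ← mul_assoc, ← pow_succ', ← pow_succ, mul_smul_comm]
          rw [nsmul_eq_mul, Nat.cast_comm]
      · have hc : Commute (b j) (c k ^ α k) :=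
          Commute.pow_right (by simpa [Ne.symm hkj] using! h.ann_cre j k) _
        have hc' : Commute (c j) (c k ^ α k) := Commute.pow_right (h.cre_comm j k) _
        simpa [hkj] using (hc'.mul_left hc).eq
    simp only [List.map_cons, List.prod_cons, List.sum_cons]
    rw [← mul_assoc, h1, mul_assoc, add_mul, ih, Nat.cast_add, mul_assoc, Nat.cast_comm, ← mul_add]
    congr 2
    abel

end ManyModes

section Quartic

variable {b c : A}

/-- Selection rule: in an eigenstate of `N` the commutator `[N, X] = m X` has expectation zero. -/
theorem map_eq_zero_of_number_shift {ℓ : A →ₗ[ℂ] ℂ} {N X : A} {n m : ℂ} (hm : m ≠ 0)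
    (hl : ∀ Y, ℓ (N * Y) = n * ℓ Y) (hr : ∀ Y, ℓ (Y * N) = n * ℓ Y)
    (hX : N * X = X * N + m • X) : ℓ X = 0 := by
  have h := congrArg ℓ hX
  rw [map_add, hl, hr, map_smul, smul_eq_mul, left_eq_add] at h
  exact (mul_eq_zero.1 h).resolve_left hm

/-- The second and the fourth moment of `b + b^*` in a number state. -/
theorem map_quadrature_moments (h : b * c = c * b + 1) {ℓ : A →ₗ[ℂ] ℂ} {n : ℂ} (h1 : ℓ 1 = 1)
    (hl : ∀ Y, ℓ (c * b * Y) = n * ℓ Y) (hr : ∀ Y, ℓ (Y * (c * b)) = n * ℓ Y) :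
    ℓ ((b + c) * (b + c)) = 2 * n + 1 ∧
      ℓ ((b + c) * ((b + c) * ((b + c) * (b + c)))) = 6 * n ^ 2 + 6 * n + 3 := by
  set N := c * b with hN
  have hNb : N * b = b * N + (-1 : ℂ) • b := by
    rw [hN, ← mul_assoc, h]; simp [add_mul, hN]
  have hNc : N * c = c * N + (1 : ℂ) • c := by
    rw [hN, mul_assoc, h]; simp [mul_add, hN]
  have shift : ∀ {X Y : A} {s t : ℂ}, N * X = X * N + s • X → N * Y = Y * N + t • Y →
      N * (X * Y) = X * Y * N + (s + t) • (X * Y) := by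
    intro X Y s t hX hY
    rw [← mul_assoc, hX, add_mul, mul_assoc, hY, mul_add, smul_mul_assoc, mul_smul_comm, add_smul,
      mul_assoc]
    abel
  have hNb2 := shift hNb hNb
  have hNc2 := shift hNc hNc
  have zb2 : ℓ (b * b) = 0 := map_eq_zero_of_number_shift (by norm_num) hl hr hNb2
  have zc2 : ℓ (c * c) = 0 := map_eq_zero_of_number_shift (by norm_num) hl hr hNc2
  have zb4 : ℓ (b * b * (b * b)) = 0 :=
    map_eq_zero_of_number_shift (by norm_num) hl hr (shift hNb2 hNb2)
  have zc4 : ℓ (c * c * (c * c)) = 0 :=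
    map_eq_zero_of_number_shift (by norm_num) hl hr (shift hNc2 hNc2)
  have hN1 : ℓ N = n := by have := hr 1; rwa [one_mul, h1, mul_one] at this
  have hsq : (b + c) * (b + c) = b * b + c * c + ((2 : ℂ) • N + 1) := by
    rw [add_mul, mul_add, mul_add, h, two_smul, ← hN]; abel
  have e1 : c * c * (b * b) = N * N - N := by
    have : c * b = b * c - 1 := by rw [h]; abel
    calc c * c * (b * b) = c * (c * b) * b := by simp only [mul_assoc]
      _ = c * (b * c - 1) * b := by rw [this]
      _ = N * N - N := by rw [hN, mul_sub, sub_mul, mul_one]; simp only [mul_assoc]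
  have e2 : b * b * (c * c) = N * N + (3 : ℂ) • N + (2 : ℂ) • 1 := by
    calc b * b * (c * c) = b * (b * c) * c := by simp only [mul_assoc]
      _ = b * c * (b * c) + b * c := by
        rw [h, mul_add, add_mul, mul_one, ← h]; simp only [hN, mul_assoc]
      _ = (N + 1) * (N + 1) + (N + 1) := by rw [h]
      _ = N * N + (3 : ℂ) • N + (2 : ℂ) • 1 := by
        rw [add_mul, mul_add, one_mul, mul_one]; module
  refine ⟨by rw [hsq]; simp [zb2, zc2, hN1, h1], ?_⟩
  -- The square of `b² + c² + 2N + 1`. Words with unequally many `b` and `c` have zero expectation;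
  -- the others are polynomials in `N`.
  have hq : (b + c) * ((b + c) * ((b + c) * (b + c))) =
      b * b * (b * b) + c * c * (c * c) + b * b * (c * c) + c * c * (b * b) +
      ((2 : ℂ) • (b * b * N) + (2 : ℂ) • (c * c * N)) +
      ((2 : ℂ) • (N * (b * b)) + (2 : ℂ) • (N * (c * c))) + (2 : ℂ) • (b * b) + (2 : ℂ) • (c * c) +
      (4 : ℂ) • (N * N) + (4 : ℂ) • N + 1 := by
    rw [← mul_assoc, hsq]
    simp only [mul_add, add_mul, mul_one, one_mul, smul_mul_assoc, mul_smul_comm]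
    module
  rw [hq, e1, e2]
  simp only [map_add, map_sub, map_smul, smul_eq_mul, zb2, zc2, zb4, zc4, hl, hr, hN1, h1]
  ring

end Quartic

/-- Moving an operator through a product of operators with which it has scalar commutators. -/
theorem mul_prod_eq_sum_eraseIdx {κ : Type*} {B : A} (F : κ → A) (s : κ → ℂ) (l : List κ)
    (h : ∀ x, B * F x = F x * B + s x • 1) :
    B * (l.map F).prod = (l.map F).prod * B +
      ∑ j : Fin l.length, s (l.get j) • ((l.eraseIdx j).map F).prod := by
  induction l with
  | nil => simp
  | cons x l ih =>
    simp only [List.length_cons, Fin.sum_univ_succ, List.map_cons, List.prod_cons,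
      List.get_eq_getElem, Fin.val_zero, List.getElem_cons_zero, List.eraseIdx_cons_zero,
      Fin.val_succ, List.getElem_cons_succ, List.eraseIdx_cons_succ] at ih ⊢
    rw [← mul_assoc, h x, add_mul, mul_assoc, ih, mul_add, ← mul_assoc, smul_mul_assoc,
      one_mul, Finset.mul_sum]
    simp only [mul_smul_comm]
    abel

end LadderAlgebra

/-! ### The Weyl group as translations times phases -/

section WeylGroup

/-- Every derivative is `I ^ n` times a phase, hence bounded by `1`. -/
theorem hasTemperateGrowth_cexp_mul_I :
    (fun r : ℝ => Complex.exp (r * Complex.I)).HasTemperateGrowth := by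
  have hd : ∀ r : ℝ, HasDerivAt (fun r : ℝ => Complex.exp (r * Complex.I))
      (Complex.I * Complex.exp (r * Complex.I)) r := fun r => by
    have h := ((Complex.ofRealCLM.hasDerivAt (x := r)).mul_const Complex.I).cexp
    simpa [mul_comm] using h
  have key : ∀ n : ℕ, iteratedDeriv n (fun r : ℝ => Complex.exp (r * Complex.I)) =
      fun r : ℝ => Complex.I ^ n * Complex.exp (r * Complex.I) := by
    intro n
    induction n with
    | zero => simp
    | succ n ih =>
      ext r
      rw [iteratedDeriv_succ, ih, ((hd r).const_mul _).deriv, pow_succ, mul_assoc]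
  refine ⟨(Complex.ofRealCLM.contDiff.mul contDiff_const).cexp, fun n => ⟨0, 1, fun r => ?_⟩⟩
  rw [norm_iteratedFDeriv_eq_norm_iteratedDeriv, key]
  simp [Complex.norm_exp_ofReal_mul_I]

variable {ι : Type} [Fintype ι]

/-- The linear form `q ↦ ∑ₓ u x q_x`. -/
def coordForm (u : ι → ℝ) : Conf ι →L[ℝ] ℝ := ∑ x, u x • EuclideanSpace.proj (𝕜 := ℝ) x

theorem coordForm_apply (u : ι → ℝ) (q : Conf ι) : coordForm u q = ∑ x, u x * q x := by
  simp [coordForm]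

/-- The real phase of the Weyl operator at time `t`. -/
def weylPhase (u v : ι → ℝ) (t : ℝ) (q : Conf ι) : ℝ :=
  t * coordForm u q + t ^ 2 / 2 * ∑ x, u x * v x

theorem hasTemperateGrowth_weylPhase (u v : ι → ℝ) (t : ℝ) :
    (weylPhase u v t).HasTemperateGrowth := by
  unfold weylPhase
  fun_prop

/-- The operator `exp(it(u·q + v·p))` on the Schwartz space: a translation followed by the
multiplication with a phase. -/
def weylS (u v : ι → ℝ) (t : ℝ) : SOp ι :=
  (SchwartzMap.smulLeftCLM ℂ fun q : Conf ι =>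
    Complex.exp (weylPhase u v t q * Complex.I)).toLinearMap ∘ₗ
  (SchwartzMap.compSubConstCLM ℂ (-(t • WithLp.toLp 2 v) : Conf ι)).toLinearMap

theorem weylS_apply (u v : ι → ℝ) (t : ℝ) (w : 𝓢(Conf ι, ℂ)) (q : Conf ι) :
    weylS u v t w q =
      Complex.exp (weylPhase u v t q * Complex.I) * w (q + t • WithLp.toLp 2 v) := by
  have h : (fun q : Conf ι => Complex.exp (weylPhase u v t q * Complex.I)).HasTemperateGrowth :=
    hasTemperateGrowth_cexp_mul_I.comp (hasTemperateGrowth_weylPhase u v t)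
  refine (SchwartzMap.smulLeftCLM_apply_apply h _ q).trans ?_
  simp

theorem weylS_zero (u v : ι → ℝ) : weylS u v 0 = 1 := by
  ext w q
  simp [weylS_apply, weylPhase]

/-- Evaluating the inner phase at the translated point creates the cross term `s t u·v`, exactly the
one in `(s + t)² / 2 * u·v`. The quadratic part of the phase exists for this reason. -/
theorem weylS_add (u v : ι → ℝ) (s t : ℝ) : weylS u v (s + t) = weylS u v s * weylS u v t := by
  ext w q
  rw [Module.End.mul_apply, weylS_apply, weylS_apply, weylS_apply, ← mul_assoc, ← Complex.exp_add,
    ← add_mul, ← Complex.ofReal_add]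
  congr 2
  · congr 3
    simp only [weylPhase, map_add, map_smul, smul_eq_mul]
    rw [coordForm_apply u (WithLp.toLp 2 v)]
    ring
  · rw [add_smul, add_assoc]

/-- The phase is unimodular and Lebesgue measure is translation invariant. -/
theorem norm_embed_weylS (u v : ι → ℝ) (t : ℝ) (w : 𝓢(Conf ι, ℂ)) :
    ‖embed (weylS u v t w)‖ = ‖embed w‖ := by
  have h : inner ℂ (embed (weylS u v t w)) (embed (weylS u v t w)) =
      inner ℂ (embed w) (embed w) := by
    rw [inner_embed, inner_embed,
      ← integral_add_right_eq_self (fun q => (starRingEnd ℂ) (w q) * w q) (t • WithLp.toLp 2 v)]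
    congr 1; ext q
    rw [weylS_apply, map_mul, mul_mul_mul_comm, ← Complex.normSq_eq_conj_mul_self,
      Complex.normSq_eq_norm_sq, Complex.norm_exp_ofReal_mul_I]
    simp
  rw [inner_self_eq_norm_sq_to_K, inner_self_eq_norm_sq_to_K] at h
  have h' : ‖embed (weylS u v t w)‖ ^ 2 = ‖embed w‖ ^ 2 := by exact_mod_cast h
  exact (pow_left_inj₀ (norm_nonneg _) (norm_nonneg _) two_ne_zero).1 h'

/-- `weylS u v t` as a linear equivalence of the Schwartz space. -/
def weylSEquiv (u v : ι → ℝ) (t : ℝ) : 𝓢(Conf ι, ℂ) ≃ₗ[ℂ] 𝓢(Conf ι, ℂ) :=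
  LinearEquiv.ofLinearMap (weylS u v t) (weylS u v (-t))
    (by rw [← Module.End.mul_eq_comp, ← weylS_add, add_neg_cancel, weylS_zero]; rfl)
    (by rw [← Module.End.mul_eq_comp, ← weylS_add, neg_add_cancel, weylS_zero]; rfl)

/-- The Weyl group on `L²`. -/
def weylU (u v : ι → ℝ) (t : ℝ) : Hilb ι ≃ₗᵢ[ℂ] Hilb ι :=
  (weylSEquiv u v t).extendOfIsometry embed embed denseRange_embed denseRange_embed
    (norm_embed_weylS u v t)

theorem weylU_embed (u v : ι → ℝ) (t : ℝ) (w : 𝓢(Conf ι, ℂ)) :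
    weylU u v t (embed w) = embed (weylS u v t w) :=
  LinearEquiv.extendOfIsometry_eq _ _ _ _ _ _ _

theorem linearIsometryEquiv_ext_embed {V W : Hilb ι ≃ₗᵢ[ℂ] Hilb ι}
    (h : ∀ w, V (embed w) = W (embed w)) : V = W := by
  have := denseRange_embed.equalizer V.continuous W.continuous (funext h)
  exact LinearIsometryEquiv.ext (congrFun this)

theorem weylU_add (u v : ι → ℝ) (s t : ℝ) : weylU u v (s + t) = weylU u v s * weylU u v t :=
  linearIsometryEquiv_ext_embed fun w => by
    change _ = weylU u v s (weylU u v t (embed w))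
    rw [weylU_embed, weylU_embed, weylU_embed, weylS_add]; rfl

variable [DecidableEq ι]

theorem fderiv_sum_coord (w : 𝓢(Conf ι, ℂ)) (q : Conf ι) (d : ι → ℝ) :
    ∑ x, (d x : ℂ) * fderiv ℝ w q (EuclideanSpace.single x 1) =
      fderiv ℝ w q (WithLp.toLp 2 d) := by
  have hd : (WithLp.toLp 2 d : Conf ι) = ∑ x, d x • EuclideanSpace.single x (1 : ℝ) := by
    ext y
    simp [Finset.sum_apply, Pi.single_apply]
  rw [hd, map_sum]
  simp

theorem lin_ofReal_apply (u v : ι → ℝ) (w : 𝓢(Conf ι, ℂ)) (q : Conf ι) :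
    Complex.I * lin (fun x => (u x : ℂ)) (fun x => (v x : ℂ)) w q =
      Complex.I * (∑ x, u x * q x : ℝ) * w q + fderiv ℝ w q (WithLp.toLp 2 v) := by
  rw [lin_apply, ← fderiv_sum_coord, mul_add, Finset.mul_sum Finset.univ _ Complex.I]
  push_cast
  rw [mul_assoc]
  congr 1
  refine Finset.sum_congr rfl fun x _ => ?_
  linear_combination -(v x : ℂ) * fderiv ℝ w q (EuclideanSpace.single x 1) * Complex.I_mul_I

/-- The Weyl operators intertwine linear combinations of positions and momenta with their
translates. -/
theorem weylS_mul_lin (u v : ι → ℝ) (t : ℝ) (c d : ι → ℂ) :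
    weylS u v t * lin c d =
      lin c d * weylS u v t + (t * ∑ x, (c x * v x - d x * u x)) • weylS u v t := by
  ext w q
  have hphase : HasFDerivAt (fun q : Conf ι => Complex.exp (weylPhase u v t q * Complex.I))
      ((Complex.exp (weylPhase u v t q * Complex.I) * Complex.I) • Complex.ofRealCLM.comp
        (t • coordForm u)) q := by
    have h1 : HasFDerivAt (weylPhase u v t) (t • coordForm u) q :=
      ((coordForm u).hasFDerivAt.const_smul t).add_const (t ^ 2 / 2 * ∑ x, u x * v x)
    refine ((Complex.ofRealCLM.hasFDerivAt.comp q h1).mul_const Complex.I).cexp.congr_fderiv ?_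
    rw [smul_smul]; rfl
  have hS : HasFDerivAt (weylS u v t w)
      (Complex.exp (weylPhase u v t q * Complex.I) • fderiv ℝ w (q + t • WithLp.toLp 2 v) +
        ((Complex.exp (weylPhase u v t q * Complex.I) * Complex.I) • Complex.ofRealCLM.comp
        (t • coordForm u)).smulRight
          (w (q + t • WithLp.toLp 2 v))) q := by
    have h4 : HasFDerivAt (fun q : Conf ι => w (q + t • WithLp.toLp 2 v))
        (fderiv ℝ w (q + t • WithLp.toLp 2 v)) q := by
      have := (w.hasFDerivAt (q + t • WithLp.toLp 2 v)).comp q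
        ((hasFDerivAt_id q).add_const (t • WithLp.toLp 2 v))
      simpa using! this
    exact (hphase.smul h4).congr_of_eventuallyEq
      (Filter.Eventually.of_forall fun y => weylS_apply u v t w y)
  have e1 : ∀ x, fderiv ℝ (weylS u v t w) q (EuclideanSpace.single x 1) =
      Complex.exp (weylPhase u v t q * Complex.I) *
        (fderiv ℝ w (q + t • WithLp.toLp 2 v) (EuclideanSpace.single x 1) +
          Complex.I * t * u x * w (q + t • WithLp.toLp 2 v)) := by
    intro x
    rw [hS.fderiv]
    simp [coordForm_apply]
    ring
  simp only [Module.End.mul_apply, LinearMap.add_apply, LinearMap.smul_apply, add_apply,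
    smul_apply, smul_eq_mul, weylS_apply u v t, lin_apply, e1]
  set E := Complex.exp (weylPhase u v t q * Complex.I)
  set w' := w (q + t • WithLp.toLp 2 v)
  have hA : ∑ x, c x * ((q + t • WithLp.toLp 2 v : Conf ι) x : ℂ) =
      ∑ x, c x * (q x : ℂ) + t * ∑ x, c x * v x := by
    rw [Finset.mul_sum, ← Finset.sum_add_distrib]
    refine Finset.sum_congr rfl fun x _ => ?_
    simp only [PiLp.add_apply, PiLp.smul_apply, smul_eq_mul]
    push_cast
    ring
  have hB : ∀ D : ι → ℂ, ∑ x, d x * (-Complex.I * (E * (D x + Complex.I * t * u x * w'))) =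
      E * ∑ x, d x * (-Complex.I * D x) + t * (∑ x, d x * u x) * (E * w') := by
    intro D
    rw [Finset.mul_sum, Finset.mul_sum, Finset.sum_mul, ← Finset.sum_add_distrib]
    refine Finset.sum_congr rfl fun x _ => ?_
    linear_combination -(d x * E * t * u x * w') * Complex.I_mul_I
  rw [hA, hB, Finset.sum_sub_distrib]
  ring

end WeylGroup

/-! ### Uniform Taylor and decay estimates -/

section Taylor

/-- Second order Taylor estimate at `0` for a curve in a normed space. -/
theorem norm_sub_sub_le_of_norm_deriv_deriv_le {E : Type*} [NormedAddCommGroup E]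
    [NormedSpace ℝ E] {φ φ' φ'' : ℝ → E} (h : ∀ t, HasDerivAt φ (φ' t) t)
    (h' : ∀ t, HasDerivAt φ' (φ'' t) t) {K : ℝ} (hK : ∀ t, |t| ≤ 1 → ‖φ'' t‖ ≤ K)
    {t : ℝ} (ht : |t| ≤ 1) : ‖φ t - φ 0 - t • φ' 0‖ ≤ K * t ^ 2 := by
  have hK0 : 0 ≤ K := (norm_nonneg _).trans (hK 0 (by simp))
  have hconv : Convex ℝ (Metric.closedBall (0 : ℝ) |t|) := convex_closedBall _ _
  have hmem : ∀ s ∈ Metric.closedBall (0 : ℝ) |t|, |s| ≤ |t| := fun s hs => by simpa using hs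
  have h0 : (0 : ℝ) ∈ Metric.closedBall (0 : ℝ) |t| := by simp
  have h1 : ∀ s ∈ Metric.closedBall (0 : ℝ) |t|, ‖φ' s - φ' 0‖ ≤ K * |t| := fun s hs => by
    have := hconv.norm_image_sub_le_of_norm_hasDerivWithin_le
      (fun r _ => (h' r).hasDerivWithinAt) (fun r hr => hK r ((hmem r hr).trans ht)) h0 hs
    refine this.trans (mul_le_mul_of_nonneg_left ?_ hK0)
    simpa using hmem s hs
  have h2 : ∀ s, HasDerivAt (fun s => φ s - s • φ' 0) (φ' s - φ' 0) s := fun s => by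
    simpa using! (h s).sub ((hasDerivAt_id s).smul_const (φ' 0))
  have h3 := hconv.norm_image_sub_le_of_norm_hasDerivWithin_le
    (fun r _ => (h2 r).hasDerivWithinAt) h1 h0 (by simp : t ∈ Metric.closedBall (0 : ℝ) |t|)
  calc ‖φ t - φ 0 - t • φ' 0‖ = ‖φ t - t • φ' 0 - (φ 0 - (0 : ℝ) • φ' 0)‖ := by
        congr 1; simp; abel
    _ ≤ K * |t| * ‖t - 0‖ := h3
    _ = K * t ^ 2 := by rw [sub_zero, Real.norm_eq_abs, mul_assoc, abs_mul_abs_self, pow_two]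

/-- A majorant common to all translates with `|s| ≤ 1`, needed to integrate a pointwise Taylor
remainder. -/
theorem exists_norm_translate_le {E F : Type*} [NormedAddCommGroup E]
    [NormedSpace ℝ E] [NormedAddCommGroup F] [NormedSpace ℝ F] (w : 𝓢(E, F)) (v : E) (k : ℕ) :
    ∃ K, 0 ≤ K ∧ ∀ (s : ℝ) (q : E), |s| ≤ 1 → ‖w (q + s • v)‖ ≤ K * (1 + ‖q‖) ^ (-k : ℝ) := by
  set C := 2 ^ k * ((Finset.Iic (k, 0)).sup fun m => SchwartzMap.seminorm ℝ m.1 m.2) w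
  have hC : ∀ x, (1 + ‖x‖) ^ k * ‖w x‖ ≤ C := fun x => by
    simpa using SchwartzMap.one_add_le_sup_seminorm_apply (𝕜 := ℝ) (m := (k, 0)) le_rfl le_rfl w x
  have hC0 : 0 ≤ C := (by positivity : (0 : ℝ) ≤ (1 + ‖(0 : E)‖) ^ k * ‖w 0‖).trans (hC 0)
  refine ⟨(1 + ‖v‖) ^ k * C, by positivity, fun s q hs => ?_⟩
  -- Weights at `q` and at a bounded translate of `q` are comparable; the `k`-th power of `1 + ‖v‖`
  -- is the price.
  have hq : 1 + ‖q‖ ≤ (1 + ‖v‖) * (1 + ‖q + s • v‖) := by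
    have h1 : ‖q‖ ≤ ‖q + s • v‖ + ‖s • v‖ := by
      simpa using norm_sub_le (q + s • v) (s • v)
    have h2 : ‖s • v‖ ≤ ‖v‖ := by
      rw [norm_smul]; exact mul_le_of_le_one_left (norm_nonneg _) hs
    nlinarith [norm_nonneg v, norm_nonneg (q + s • v)]
  have hpos : 0 < (1 + ‖q‖) ^ k := by positivity
  rw [Real.rpow_neg (by positivity), Real.rpow_natCast, ← div_eq_mul_inv, le_div_iff₀ hpos]
  calc ‖w (q + s • v)‖ * (1 + ‖q‖) ^ k
      ≤ ‖w (q + s • v)‖ * ((1 + ‖v‖) * (1 + ‖q + s • v‖)) ^ k := by gcongr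
    _ = (1 + ‖v‖) ^ k * ((1 + ‖q + s • v‖) ^ k * ‖w (q + s • v)‖) := by rw [mul_pow]; ring
    _ ≤ _ := by gcongr; exact hC _

end Taylor

/-! ### The generator of the Weyl group and Stone uniqueness -/

section WeylDerivative

variable {ι : Type} [Fintype ι]

/-- A sufficiently large negative power of `1 + ‖q‖` is square integrable, so pointwise decay
controls the `L²` norm. -/
theorem exists_norm_embed_le :
    ∃ (k : ℕ) (N : ℝ), 0 ≤ N ∧ ∀ (w : 𝓢(Conf ι, ℂ)) (B : ℝ), 0 ≤ B →
      (∀ q, ‖w q‖ ≤ B * (1 + ‖q‖) ^ (-k : ℝ)) → ‖embed w‖ ≤ B * N := by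
  have hT : (volume : Measure (Conf ι)).HasTemperateGrowth := inferInstance
  obtain ⟨k, hk⟩ := hT.exists_eLpNorm_lt_top 2
  refine ⟨k, (eLpNorm (fun q : Conf ι => (1 + ‖q‖) ^ (-k : ℝ)) 2 volume).toReal,
    ENNReal.toReal_nonneg, fun w B hB h => ?_⟩
  have h1 : eLpNorm w 2 volume ≤
      ENNReal.ofReal B * eLpNorm (fun q : Conf ι => (1 + ‖q‖) ^ (-k : ℝ)) 2 volume :=
    eLpNorm_le_mul_eLpNorm_of_ae_le_mul (Filter.Eventually.of_forall fun q => by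
      rw [Real.norm_of_nonneg (by positivity)]; exact h q) 2
  have h2 := ENNReal.toReal_mono (ENNReal.mul_ne_top ENNReal.ofReal_ne_top hk.ne) h1
  rw [ENNReal.toReal_mul, ENNReal.toReal_ofReal hB] at h2
  exact (SchwartzMap.norm_toLp (f := w) (p := 2) (μ := volume)).trans_le h2

variable [DecidableEq ι] (u v : ι → ℝ)

/-- The field operator `∑ₓ (u x q_x + v x p_x)` with real coefficients. -/
abbrev realField : SOp ι := lin (fun x => (u x : ℂ)) (fun x => (v x : ℂ))

theorem weylS_mul_realField (t : ℝ) :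
    weylS u v t * realField u v = realField u v * weylS u v t := by
  rw [weylS_mul_lin]
  simp [mul_comm]

theorem hasDerivAt_weylS_apply_zero (w : 𝓢(Conf ι, ℂ)) (q : Conf ι) :
    HasDerivAt (fun t => weylS u v t w q) (Complex.I * realField u v w q) 0 := by
  have h1 : HasDerivAt (fun t => weylPhase u v t q) (∑ x, u x * q x) 0 := by
    have := ((hasDerivAt_id (0 : ℝ)).mul_const (coordForm u q)).add
      ((((hasDerivAt_id (0 : ℝ)).pow 2).div_const 2).mul_const (∑ x, u x * v x))
    simpa [coordForm_apply, weylPhase] using! this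
  have h2 : HasDerivAt (fun t : ℝ => w (q + t • WithLp.toLp 2 v))
      (fderiv ℝ w q (WithLp.toLp 2 v)) 0 := by
    have h := (w.hasFDerivAt (q + (0 : ℝ) • WithLp.toLp 2 v)).comp_hasDerivAt 0
      (((hasDerivAt_id (0 : ℝ)).smul_const (WithLp.toLp 2 v : Conf ι)).const_add q)
    simpa using! h
  have h3 := ((h1.ofReal_comp.mul_const Complex.I).cexp).mul h2
  have h4 : (fun t => weylS u v t w q) = fun t : ℝ =>
      Complex.exp (weylPhase u v t q * Complex.I) * w (q + t • WithLp.toLp 2 v) :=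
    funext fun t => weylS_apply u v t w q
  rw [h4]
  convert! h3 using 1
  rw [lin_ofReal_apply]
  simp [weylPhase, mul_comm]

/-- The group law reduces to time zero, and the group commutes with its own generator. -/
theorem hasDerivAt_weylS_apply (w : 𝓢(Conf ι, ℂ)) (q : Conf ι) (t : ℝ) :
    HasDerivAt (fun t => weylS u v t w q) (weylS u v t ((Complex.I • realField u v) w) q) t := by
  have h := hasDerivAt_weylS_apply_zero u v (weylS u v t w) q
  have h' : HasDerivAt (fun s => weylS u v (s - t) (weylS u v t w) q)
      (Complex.I * realField u v (weylS u v t w) q) t := by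
    rw [← sub_self t] at h
    exact h.comp_sub_const t t
  convert h' using 1
  · ext s
    rw [← Module.End.mul_apply, ← weylS_add, sub_add_cancel]
  · rw [LinearMap.smul_apply, map_smul, smul_apply, ← Module.End.mul_apply, weylS_mul_realField]
    rfl

/-- With `G` the generator, the second time derivative at `q` is a phase times `(G (G w)) (q + s
v)`. Its decay is uniform in `|s| ≤ 1`, so the pointwise Taylor remainder is `O(t²)` in `L²` as
well. -/
theorem hasDerivAt_embed_weylS_zero (w : 𝓢(Conf ι, ℂ)) :
    HasDerivAt (fun t => embed (weylS u v t w)) (Complex.I • embed (realField u v w)) 0 := by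
  set G : SOp ι := Complex.I • realField u v with hG
  obtain ⟨k, N, hN, hnorm⟩ := exists_norm_embed_le (ι := ι)
  obtain ⟨K, hK, hbound⟩ := exists_norm_translate_le (G (G w)) (WithLp.toLp 2 v) k
  have key : ∀ t : ℝ, |t| ≤ 1 →
      ‖embed (weylS u v t w) - embed w - t • embed (G w)‖ ≤ K * N * t ^ 2 := by
    intro t ht
    have e : embed (weylS u v t w) - embed w - t • embed (G w) =
        embed (weylS u v t w - w - (t : ℂ) • G w) := by
      rw [map_sub, map_sub, map_smul, Complex.coe_smul]; rfl
    rw [e]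
    refine (hnorm _ (K * t ^ 2) (by positivity) fun q => ?_).trans_eq (by ring)
    have := norm_sub_sub_le_of_norm_deriv_deriv_le
      (fun s => hasDerivAt_weylS_apply u v w q s)
      (fun s => hasDerivAt_weylS_apply u v (G w) q s)
      (K := K * (1 + ‖q‖) ^ (-k : ℝ)) (fun s hs => by
        rw [weylS_apply, norm_mul, Complex.norm_exp_ofReal_mul_I, one_mul]
        exact hbound s q hs) ht
    simp only [weylS_zero, Module.End.one_apply] at this
    simp only [sub_apply, smul_apply, Complex.real_smul, smul_eq_mul] at this ⊢
    exact this.trans_eq (by ring)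
  have e2 : Complex.I • embed (realField u v w) = embed (G w) := by
    rw [hG, LinearMap.smul_apply, map_smul]
  rw [e2, hasDerivAt_iff_isLittleO_nhds_zero]
  have hO : (fun t : ℝ => embed (weylS u v (0 + t) w) - embed (weylS u v 0 w) - t • embed (G w))
      =O[nhds 0] fun t : ℝ => t ^ 2 := by
    refine Asymptotics.IsBigO.of_bound (K * N) ?_
    filter_upwards [Metric.closedBall_mem_nhds (0 : ℝ) one_pos] with t ht
    rw [zero_add, weylS_zero, norm_pow, Real.norm_eq_abs, sq_abs]
    exact key t (by simpa using ht)
  refine hO.trans_isLittleO ?_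
  simpa using! Asymptotics.isLittleO_pow_id (𝕜 := ℝ) (n := 2) (by norm_num)

theorem hasDerivAt_embed_weylS (w : 𝓢(Conf ι, ℂ)) (t : ℝ) :
    HasDerivAt (fun t => embed (weylS u v t w))
      (Complex.I • embed (realField u v (weylS u v t w))) t := by
  have h := hasDerivAt_embed_weylS_zero u v (weylS u v t w)
  rw [← sub_self t] at h
  convert! h.comp_sub_const t t using 1
  ext s : 1
  rw [← Module.End.mul_apply, ← weylS_add, sub_add_cancel]

/-- Orbits of Schwartz functions are differentiable; since all operators are isometries, orbits of
other vectors are uniform limits of these. -/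
theorem continuous_weylU (φ : Hilb ι) : Continuous fun t => weylU u v t φ := by
  refine continuous_of_uniform_approx_of_continuous fun s hs => ?_
  obtain ⟨ε, hε, hεs⟩ := Metric.mem_uniformity_dist.1 hs
  obtain ⟨w, hw⟩ := denseRange_embed.exists_dist_lt φ hε
  refine ⟨fun t => weylU u v t (embed w), ?_, fun t => hεs ?_⟩
  · simp only [weylU_embed]
    exact continuous_iff_continuousAt.2 fun t => (hasDerivAt_embed_weylS u v w t).continuousAt
  · rwa [LinearIsometryEquiv.dist_map]

theorem isUnitaryExp_weylU : IsUnitaryExp (realField u v) (weylU u v 1) :=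
  ⟨weylU u v, weylU_add u v, continuous_weylU u v, fun w => by
    have h := hasDerivAt_embed_weylS_zero u v w
    simp only [← weylU_embed] at h
    exact h, rfl⟩

/-- Stone uniqueness: a unitary group whose generator agrees with the field operator on the
Schwartz space is the Weyl group. -/
theorem eq_weylU_of_isUnitaryExp {W : Hilb ι ≃ₗᵢ[ℂ] Hilb ι}
    (hW : IsUnitaryExp (realField u v) W) : W = weylU u v 1 := by
  obtain ⟨V, hV, -, hd, rfl⟩ := hW
  have hV0 : ∀ φ, V 0 φ = φ := fun φ => by
    have h : V 0 φ = V 0 (V 0 φ) := by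
      conv_lhs => rw [← add_zero (0 : ℝ), hV]
      rfl
    exact ((V 0).injective h).symm
  have hVV : ∀ s t φ, V (s + t) φ = V s (V t φ) := fun s t φ => by rw [hV]; rfl
  refine linearIsometryEquiv_ext_embed fun w => ?_
  rw [weylU_embed]
  -- The increment is `V (-(t + s))` applied to the difference of the two groups at time `s` on the
  -- Schwartz vector `wt`. As `V` is isometric, only the derivatives at time zero on Schwartz
  -- functions matter, and they agree.
  have hderiv : ∀ t, HasDerivAt (fun t => V (-t) (embed (weylS u v t w))) 0 t := by
    intro t
    set wt := weylS u v t w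
    have h1 := hasDerivAt_embed_weylS_zero u v wt
    have h2 : HasDerivAt (fun s => V s (embed wt)) (Complex.I • embed (realField u v wt)) 0 := hd wt
    have h3 := h1.sub h2
    rw [sub_self, hasDerivAt_iff_isLittleO_nhds_zero] at h3
    rw [hasDerivAt_iff_isLittleO_nhds_zero]
    refine Asymptotics.IsLittleO.of_norm_left (h3.norm_left.congr_left fun s => ?_)
    have e : V (-(t + s)) (embed (weylS u v (t + s) w)) - V (-t) (embed wt) =
        V (-(t + s)) (embed (weylS u v s wt) - V s (embed wt)) := by
      rw [map_sub, ← hVV, add_comm t s, weylS_add, neg_add_rev, neg_add_cancel_right]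
      rfl
    simp only [smul_zero, sub_zero]
    rw [e, LinearIsometryEquiv.norm_map]
    simp [weylS_zero, hV0]
  have hconst := is_const_of_deriv_eq_zero (fun t => (hderiv t).differentiableAt)
    (fun t => (hderiv t).deriv) 1 0
  simp only [weylS_zero, neg_zero, hV0, Module.End.one_apply] at hconst
  rw [← hconst, ← hVV, add_neg_cancel, hV0]

theorem isWeyl_iff {f : ι → ℂ} {W : Hilb ι ≃ₗᵢ[ℂ] Hilb ι} :
    IsWeyl f W ↔ IsUnitaryExp (realField (fun x => (f x).re) (fun x => (f x).im)) W := by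
  unfold IsWeyl
  rw [field_eq_lin]

theorem existsUnique_isWeyl (f : ι → ℂ) : ∃! W, IsWeyl f W :=
  ⟨weylU (fun x => (f x).re) (fun x => (f x).im) 1,
    isWeyl_iff.2 (isUnitaryExp_weylU _ _),
    fun _ hW => eq_weylU_of_isUnitaryExp _ _ (isWeyl_iff.1 hW)⟩

theorem isWeyl_apply_toHilb {f : ι → ℂ} {W : Hilb ι ≃ₗᵢ[ℂ] Hilb ι} (hW : IsWeyl f W)
    (w : 𝓢(Conf ι, ℂ)) :
    W (toHilb w) = embed (weylS (fun x => (f x).re) (fun x => (f x).im) 1 w) := by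
  rw [eq_weylU_of_isUnitaryExp _ _ (isWeyl_iff.1 hW)]
  exact weylU_embed _ _ 1 w

end WeylDerivative

/-! ### Gaussians are Schwartz functions -/

section Gaussian

/-- By the bound for iterated derivatives of a composition, each derivative of `exp ∘ f` is at most
a polynomial times `exp (f q)`, and the Gaussian bound on `f` beats every polynomial. -/
theorem exp_comp_decay {E : Type*} [NormedAddCommGroup E] [NormedSpace ℝ E] {f : E → ℝ}
    (hf : f.HasTemperateGrowth) {c : ℝ} (hc : 0 < c) (h : ∀ q, f q ≤ -c * ‖q‖ ^ 2) (k n : ℕ) :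
    ∃ C, ∀ q, ‖q‖ ^ k * ‖iteratedFDeriv ℝ n (fun q => Real.exp (f q)) q‖ ≤ C := by
  obtain ⟨m, D, hD, hfD⟩ := hf.norm_iteratedFDeriv_le_uniform n
  set N : ℕ := k + m * n
  -- `N² / (4c)` is the maximum of `N r - c r²`.
  refine ⟨n.factorial * (1 + D) ^ n * Real.exp (N ^ 2 / (4 * c)), fun q => ?_⟩
  have hq : 0 ≤ ‖q‖ := norm_nonneg q
  have h1 : ‖iteratedFDeriv ℝ n (Real.exp ∘ f) q‖ ≤
      n.factorial * Real.exp (f q) * ((1 + D) * (1 + ‖q‖) ^ m) ^ n := by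
    refine norm_iteratedFDeriv_comp_le Real.contDiff_exp hf.1 (mod_cast le_top) q
      (fun i _ => ?_) (fun i hi hin => ?_)
    · rw [norm_iteratedFDeriv_eq_norm_iteratedDeriv, iteratedDeriv_eq_iterate, Real.iter_deriv_exp,
        Real.norm_of_nonneg (Real.exp_pos _).le]
    · refine (hfD i hin q).trans (le_trans (b := (1 + D) * (1 + ‖q‖) ^ m) ?_ ?_)
      · gcongr; simp
      -- Enlarging `D` to `1 + D` makes the base at least `1`, hence below its `i`-th power.
      · exact le_self_pow₀ (one_le_mul_of_one_le_of_one_le (by linarith)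
          (one_le_pow₀ (by linarith))) (by omega)
  have h2 : (1 + ‖q‖) ^ N * Real.exp (f q) ≤ Real.exp (N ^ 2 / (4 * c)) := by
    have h3 : (1 + ‖q‖) ^ N ≤ Real.exp (N * ‖q‖) := by
      rw [Real.exp_nat_mul]
      exact pow_le_pow_left₀ (by linarith) (by linarith [Real.add_one_le_exp ‖q‖]) _
    calc (1 + ‖q‖) ^ N * Real.exp (f q) ≤ Real.exp (N * ‖q‖) * Real.exp (-c * ‖q‖ ^ 2) := by
          gcongr; exact h q
      _ = Real.exp (N * ‖q‖ + -c * ‖q‖ ^ 2) := (Real.exp_add _ _).symm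
      _ ≤ Real.exp (N ^ 2 / (4 * c)) := by
          rw [Real.exp_le_exp, le_div_iff₀ (by positivity)]
          nlinarith [sq_nonneg ((N : ℝ) - 2 * c * ‖q‖)]
  calc ‖q‖ ^ k * ‖iteratedFDeriv ℝ n (fun q => Real.exp (f q)) q‖
      ≤ (1 + ‖q‖) ^ k * (n.factorial * Real.exp (f q) * ((1 + D) * (1 + ‖q‖) ^ m) ^ n) := by
        gcongr
        · linarith
        · exact h1
    _ = n.factorial * (1 + D) ^ n * ((1 + ‖q‖) ^ N * Real.exp (f q)) := by
        rw [mul_pow, ← pow_mul, pow_add]; ring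
    _ ≤ _ := by gcongr

/-- The function `exp ∘ f` as a Schwartz function, for `f` of temperate growth which is bounded
above by `-c ‖q‖²`. -/
def expSchwartz {E : Type*} [NormedAddCommGroup E] [NormedSpace ℝ E] (f : E → ℝ)
    (hf : f.HasTemperateGrowth) {c : ℝ} (hc : 0 < c) (h : ∀ q, f q ≤ -c * ‖q‖ ^ 2) : 𝓢(E, ℝ) where
  toFun q := Real.exp (f q)
  smooth' := hf.1.exp
  decay' := exp_comp_decay hf hc h

end Gaussian

/-! ### Existence and uniqueness of the vacuum -/

section Vacuum

variable {ι : Type} [Fintype ι] {O : Matrix ι ι ℝ} {γ : ι → ℝ}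

/-- The linear form `q ↦ (Oᵀ q)_j`. -/
abbrev modeForm (O : Matrix ι ι ℝ) (j : ι) : Conf ι →L[ℝ] ℝ := coordForm fun x => O x j

/-- The column `O e_j` as a point of configuration space. -/
abbrev modeVec (O : Matrix ι ι ℝ) (j : ι) : Conf ι := WithLp.toLp 2 fun x => O x j

/-- The exponent `½ ∑ⱼ γ_j (Oᵀ q)_j²` of the ground state. -/
def groundExponent (O : Matrix ι ι ℝ) (γ : ι → ℝ) (q : Conf ι) : ℝ :=
  ∑ j, γ j / 2 * modeForm O j q ^ 2

theorem hasFDerivAt_groundExponent (O : Matrix ι ι ℝ) (γ : ι → ℝ) (q : Conf ι) :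
    HasFDerivAt (groundExponent O γ) (∑ j, (γ j * modeForm O j q) • modeForm O j) q := by
  unfold groundExponent
  refine HasFDerivAt.fun_sum fun j _ => ?_
  refine (((modeForm O j).hasFDerivAt.pow 2).const_mul (γ j / 2)).congr_fderiv ?_
  ext y
  simp
  ring

variable [DecidableEq ι]

theorem modeForm_modeVec (hO : O ∈ Matrix.orthogonalGroup ι ℝ) (j k : ι) :
    modeForm O j (modeVec O k) = if j = k then 1 else 0 := by
  rw [coordForm_apply]
  exact orthogonal_sum_col hO j k

theorem sum_modeForm_smul (hO : O ∈ Matrix.orthogonalGroup ι ℝ) (q : Conf ι) :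
    ∑ j, modeForm O j q • modeVec O j = q := by
  ext x
  have : ∀ j, (∑ y, O y j * q y) * O x j = ∑ y, q y * (O x j * O y j) := fun j => by
    rw [Finset.sum_mul]; exact Finset.sum_congr rfl fun y _ => by ring
  simp only [coordForm_apply, WithLp.ofLp_sum, WithLp.ofLp_smul, Finset.sum_apply, Pi.smul_apply,
    smul_eq_mul, this]
  rw [Finset.sum_comm]
  simp [← Finset.mul_sum, orthogonal_sum_row hO]

theorem sum_modeForm_sq (hO : O ∈ Matrix.orthogonalGroup ι ℝ) (q : Conf ι) :
    ∑ j, modeForm O j q ^ 2 = ‖q‖ ^ 2 := by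
  rw [EuclideanSpace.real_norm_sq_eq]
  have h : ∀ x, q x ^ 2 = ∑ j, modeForm O j q * O x j * q x := fun x => by
    have := congrArg (fun r : Conf ι => r x) (sum_modeForm_smul hO q)
    simp only [WithLp.ofLp_sum, WithLp.ofLp_smul, Finset.sum_apply, Pi.smul_apply,
      smul_eq_mul] at this
    rw [← Finset.sum_mul, this, pow_two]
  simp only [h]
  rw [Finset.sum_comm]
  refine Finset.sum_congr rfl fun j _ => ?_
  simp only [mul_assoc, ← Finset.mul_sum]
  rw [pow_two]
  congr 1
  rw [coordForm_apply]

/-- In the rotated coordinate `(Oᵀq)_j` the mode is the annihilation operator of a one-dimensional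
oscillator, so the vacuum condition is a first order equation along `O e_j`. -/
theorem modeAnn_apply (hγ : ∀ j, 0 < γ j) (j : ι) (w : 𝓢(Conf ι, ℂ)) (q : Conf ι) :
    modeAnn O γ j w q = (((Real.sqrt (γ j))⁻¹ / Real.sqrt 2 : ℝ) : ℂ) *
      (γ j * modeForm O j q * w q + fderiv ℝ w q (modeVec O j)) := by
  have hs : (Real.sqrt (γ j) : ℂ) ≠ 0 := by exact_mod_cast (Real.sqrt_pos.2 (hγ j)).ne'
  have hg : (γ j : ℂ) = Real.sqrt (γ j) * Real.sqrt (γ j) := by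
    rw [← Complex.ofReal_mul, Real.mul_self_sqrt (hγ j).le]
  rw [modeAnn_eq_lin, lin_apply, ← fderiv_sum_coord, coordForm_apply, hg]
  push_cast
  have h1 : ∀ x, (Real.sqrt (γ j) : ℂ) / Real.sqrt 2 * O x j * q x =
      (Real.sqrt (γ j) / Real.sqrt 2) * (O x j * q x) := fun x => by ring
  have h2 : ∀ x, Complex.I * ((Real.sqrt (γ j) : ℂ)⁻¹ / Real.sqrt 2 * O x j) *
      (-Complex.I * fderiv ℝ w q (EuclideanSpace.single x 1)) =
      ((Real.sqrt (γ j) : ℂ)⁻¹ / Real.sqrt 2) *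
        (O x j * fderiv ℝ w q (EuclideanSpace.single x 1)) := fun x => by
    linear_combination -((Real.sqrt (γ j) : ℂ)⁻¹ / Real.sqrt 2) *
        (O x j * fderiv ℝ w q (EuclideanSpace.single x 1)) * Complex.I_mul_I
  simp only [h1, h2, ← Finset.mul_sum]
  field_simp

theorem modeAnn_eq_zero_iff (hγ : ∀ j, 0 < γ j) (j : ι) (w : 𝓢(Conf ι, ℂ)) :
    modeAnn O γ j w = 0 ↔
      ∀ q, fderiv ℝ w q (modeVec O j) = -(γ j * modeForm O j q * w q) := by
  have hs : (((Real.sqrt (γ j))⁻¹ / Real.sqrt 2 : ℝ) : ℂ) ≠ 0 := by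
    have := Real.sqrt_pos.2 (hγ j)
    exact_mod_cast (by positivity : (Real.sqrt (γ j))⁻¹ / Real.sqrt 2 ≠ 0)
  refine ⟨fun h q => ?_, fun h => ?_⟩
  · have h' : modeAnn O γ j w q = 0 := by rw [h]; rfl
    rw [modeAnn_apply hγ] at h'
    linear_combination (mul_eq_zero.1 h').resolve_left hs
  · ext q
    rw [modeAnn_apply hγ, h q]
    simp

theorem groundExponent_deriv_modeVec (hO : O ∈ Matrix.orthogonalGroup ι ℝ) (q : Conf ι) (k : ι) :
    (∑ j, (γ j * modeForm O j q) • modeForm O j) (modeVec O k) = γ k * modeForm O k q := by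
  simp only [sum_apply, smul_apply, modeForm_modeVec hO]
  simp

theorem exists_groundState (hO : O ∈ Matrix.orthogonalGroup ι ℝ) (hγ : ∀ j, 0 < γ j) :
    ∃ w : 𝓢(Conf ι, ℂ), ∀ q, w q = (Real.exp (-groundExponent O γ q) : ℝ) := by
  -- The smallest frequency sets the Gaussian decay rate `c / 2`; without modes any positive number
  -- serves.
  obtain ⟨c, hc, hcγ⟩ : ∃ c, 0 < c ∧ ∀ j, c ≤ γ j := by
    rcases isEmpty_or_nonempty ι with h | h
    · exact ⟨1, one_pos, fun j => h.elim j⟩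
    · obtain ⟨j, hj⟩ := Finite.exists_min γ
      exact ⟨γ j, hγ j, hj⟩
  have hg : (fun q : Conf ι => -groundExponent O γ q).HasTemperateGrowth := by
    unfold groundExponent
    refine Function.HasTemperateGrowth.neg (Function.HasTemperateGrowth.sum fun j _ => ?_)
    exact (Function.HasTemperateGrowth.const _).mul ((modeForm O j).hasTemperateGrowth.pow 2)
  have hle : ∀ q : Conf ι, -groundExponent O γ q ≤ -(c / 2) * ‖q‖ ^ 2 := fun q => by
    rw [neg_mul, neg_le_neg_iff, ← sum_modeForm_sq hO, Finset.mul_sum, groundExponent]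
    exact Finset.sum_le_sum fun j _ =>
      mul_le_mul_of_nonneg_right (by linarith [hcγ j]) (sq_nonneg _)
  exact ⟨SchwartzMap.postcompCLM (𝕜 := ℝ) Complex.ofRealCLM
    (expSchwartz _ hg (by positivity : 0 < c / 2) hle), fun q => rfl⟩

theorem exists_isVacuum (hO : O ∈ Matrix.orthogonalGroup ι ℝ) (hγ : ∀ j, 0 < γ j) :
    ∃ ψ, IsVacuum O γ ψ := by
  obtain ⟨w, hw⟩ := exists_groundState hO hγ
  have hw' : (w : Conf ι → ℂ) = fun q => ((Real.exp (-groundExponent O γ q) : ℝ) : ℂ) := funext hw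
  have hann : ∀ j, modeAnn O γ j w = 0 := fun j => by
    rw [modeAnn_eq_zero_iff hγ]
    intro q
    have h : HasFDerivAt w (Complex.ofRealCLM.comp (Real.exp (-groundExponent O γ q) •
        -∑ j, (γ j * modeForm O j q) • modeForm O j)) q := by
      rw [hw']
      exact Complex.ofRealCLM.hasFDerivAt.comp q (hasFDerivAt_groundExponent O γ q).fun_neg.exp
    rw [h.fderiv, hw]
    simp only [ContinuousLinearMap.comp_apply, smul_apply,
      neg_apply, groundExponent_deriv_modeVec hO, Complex.ofRealCLM_apply]
    push_cast
    simp
    ring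
  have hne : embed w ≠ 0 := fun h => by
    have h0 : w = 0 := embed_injective (h.trans (map_zero _).symm)
    have := hw 0
    rw [h0] at this
    exact Complex.ofReal_ne_zero.2 (Real.exp_pos _).ne' this.symm
  refine ⟨((‖embed w‖⁻¹ : ℝ) : ℂ) • w, ?_, fun j => by rw [map_smul, hann, smul_zero]⟩
  change ‖embed _‖ = 1
  rw [map_smul, norm_smul, Complex.norm_real, norm_inv, norm_norm,
    inv_mul_cancel₀ (norm_ne_zero_iff.2 hne)]

/-- Multiplied by the inverse Gaussian, a solution has zero derivative along every column of `O`.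
The columns span, so the product is constant. -/
theorem eq_smul_of_modeAnn_eq_zero (hO : O ∈ Matrix.orthogonalGroup ι ℝ) (hγ : ∀ j, 0 < γ j)
    {ψ : 𝓢(Conf ι, ℂ)} (hψ : ∀ j, modeAnn O γ j ψ = 0) (q : Conf ι) :
    ψ q = ψ 0 * (Real.exp (-groundExponent O γ q) : ℝ) := by
  have hder : ∀ q : Conf ι, HasFDerivAt (fun q : Conf ι =>
      ((Real.exp (groundExponent O γ q) : ℝ) : ℂ) * ψ q) (0 : Conf ι →L[ℝ] ℂ) q := by
    intro q
    have h : HasFDerivAt (fun q : Conf ι => ((Real.exp (groundExponent O γ q) : ℝ) : ℂ))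
        (Complex.ofRealCLM.comp (Real.exp (groundExponent O γ q) •
          ∑ j, (γ j * modeForm O j q) • modeForm O j)) q :=
      Complex.ofRealCLM.hasFDerivAt.comp q (hasFDerivAt_groundExponent O γ q).exp
    refine (h.mul (ψ.hasFDerivAt q)).congr_fderiv (ContinuousLinearMap.ext fun y => ?_)
    rw [← sum_modeForm_smul hO y, map_sum, map_sum]
    refine Finset.sum_congr rfl fun j _ => ?_
    rw [map_smul, map_smul]
    congr 1
    simp only [add_apply, smul_apply,
      ContinuousLinearMap.comp_apply, groundExponent_deriv_modeVec hO,
      (modeAnn_eq_zero_iff hγ j ψ).1 (hψ j) q, Complex.ofRealCLM_apply]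
    push_cast
    simp
    ring
  have hc := is_const_of_fderiv_eq_zero (𝕜 := ℝ) (fun q => (hder q).differentiableAt)
    (fun q => (hder q).fderiv) q 0
  have h0 : groundExponent O γ 0 = 0 := by simp [groundExponent]
  simp only [h0, Real.exp_zero, Complex.ofReal_one, one_mul] at hc
  rw [← hc, mul_right_comm, ← Complex.ofReal_mul, ← Real.exp_add, add_neg_cancel]
  simp

theorem isVacuum_unique (hO : O ∈ Matrix.orthogonalGroup ι ℝ) (hγ : ∀ j, 0 < γ j)
    {ψ₀ ψ₁ : 𝓢(Conf ι, ℂ)} (h₀ : IsVacuum O γ ψ₀) (h₁ : IsVacuum O γ ψ₁) :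
    ∃ c : ℂ, ‖c‖ = 1 ∧ ψ₁ = c • ψ₀ := by
  have e₀ := eq_smul_of_modeAnn_eq_zero hO hγ h₀.2
  have e₁ := eq_smul_of_modeAnn_eq_zero hO hγ h₁.2
  have hne : ψ₀ 0 ≠ 0 := fun h => by
    have hz : ψ₀ = 0 := by ext q; rw [e₀ q, h]; simp
    have h1 : ‖embed ψ₀‖ = 1 := h₀.1
    rw [hz, map_zero, norm_zero] at h1
    exact zero_ne_one h1
  have heq : ψ₁ = (ψ₁ 0 / ψ₀ 0) • ψ₀ := by
    ext q
    rw [smul_apply, smul_eq_mul, e₁ q, e₀ q]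
    field_simp
  refine ⟨ψ₁ 0 / ψ₀ 0, ?_, heq⟩
  have h1 : ‖embed ψ₁‖ = 1 := h₁.1
  have h0 : ‖embed ψ₀‖ = 1 := h₀.1
  rw [heq, map_smul, norm_smul, h0, mul_one] at h1
  exact h1

end Vacuum

/-! ### The matrices `h` and `M` in the eigenbasis -/

section Matrices

variable {ι : Type} [Fintype ι] {O : Matrix ι ι ℝ} {γ : ι → ℝ}

theorem normSq_modeCoeff (hγ : ∀ j, 0 < γ j) (u v : ι → ℝ) (j : ι) :
    Complex.normSq (modeCoeff O γ u v j) =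
      ((γ j)⁻¹ * (∑ x, O x j * u x) ^ 2 + γ j * (∑ x, O x j * v x) ^ 2) / 2 := by
  have h1 : Real.sqrt (γ j) ^ 2 = γ j := Real.sq_sqrt (hγ j).le
  have h2 : Real.sqrt 2 ^ 2 = 2 := Real.sq_sqrt (by norm_num)
  rw [modeCoeff, mul_comm Complex.I, Complex.normSq_add_mul_I, mul_pow, mul_pow, div_pow, div_pow,
    inv_pow, h1, h2]
  ring

variable [DecidableEq ι]

theorem dotProduct_orthogonal_diagonal_mulVec (O : Matrix ι ι ℝ) (d u : ι → ℝ) :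
    u ⬝ᵥ (O * Matrix.diagonal d * O.transpose).mulVec u = ∑ j, d j * (∑ x, O x j * u x) ^ 2 := by
  rw [← Matrix.mulVec_mulVec, ← Matrix.mulVec_mulVec, Matrix.dotProduct_mulVec]
  refine Finset.sum_congr rfl fun j _ => ?_
  rw [Matrix.mulVec_diagonal]
  simp only [dotProduct, Matrix.vecMul, Matrix.mulVec, Matrix.transpose_apply, mul_comm (u _)]
  ring

theorem orthogonal_conj_mul (hO : O ∈ Matrix.orthogonalGroup ι ℝ) (d e : ι → ℝ) :
    O * Matrix.diagonal d * O.transpose * (O * Matrix.diagonal e * O.transpose) =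
      O * Matrix.diagonal (fun j => d j * e j) * O.transpose := by
  have h : O.transpose * O = 1 := (Matrix.mem_orthogonalGroup_iff' ι ℝ).1 hO
  calc O * Matrix.diagonal d * O.transpose * (O * Matrix.diagonal e * O.transpose)
      = O * Matrix.diagonal d * (O.transpose * O) * Matrix.diagonal e * O.transpose := by
        simp only [Matrix.mul_assoc]
    _ = _ := by rw [h, Matrix.mul_one, Matrix.mul_assoc O, Matrix.diagonal_mul_diagonal]

/-- Uniqueness of the positive square root; any diagonalization may thus be used to compute `M`. -/
theorem sqrt_eq_of_isDiagonalization {h : Matrix ι ι ℝ} (hd : IsDiagonalization h O γ) :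
    CFC.sqrt h = O * Matrix.diagonal γ * O.transpose := by
  refine CFC.sqrt_unique ?_ ?_
  · rw [orthogonal_conj_mul hd.1, hd.2.2]
    simp only [pow_two]
  · rw [Matrix.nonneg_iff_posSemidef]
    have := (Matrix.PosSemidef.diagonal (fun j => (hd.2.1 j).le)).mul_mul_conjTranspose_same O
    simpa using this

theorem inv_sqrt_eq_of_isDiagonalization {h : Matrix ι ι ℝ} (hd : IsDiagonalization h O γ) :
    (CFC.sqrt h)⁻¹ = O * Matrix.diagonal (fun j => (γ j)⁻¹) * O.transpose := by
  rw [sqrt_eq_of_isDiagonalization hd]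
  refine Matrix.inv_eq_right_inv ?_
  rw [orthogonal_conj_mul hd.1]
  have : (fun j => γ j * (γ j)⁻¹) = fun _ => (1 : ℝ) :=
    funext fun j => mul_inv_cancel₀ (hd.2.1 j).ne'
  rw [this, Matrix.diagonal_one, Matrix.mul_one]
  exact (Matrix.mem_orthogonalGroup_iff ι ℝ).1 hd.1

/-- In the eigenbasis the form is `∑ (γ_j⁻¹ (Oᵀ Re f)_j² + γ_j (Oᵀ Im f)_j²)`; the factor `2` undoes
the `1/√2` in the mode coefficients. -/
theorem dotProduct_corrMatrix_mulVec {h : Matrix ι ι ℝ} (hd : IsDiagonalization h O γ)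
    (f : ι → ℂ) :
    tilde f ⬝ᵥ (corrMatrix h).mulVec (tilde f) =
      2 * ∑ j, Complex.normSq (modeCoeff O γ (fun x => (f x).re) (fun x => (f x).im) j) := by
  rw [corrMatrix, tilde, Matrix.fromBlocks_mulVec, sumElim_dotProduct_sumElim,
    inv_sqrt_eq_of_isDiagonalization hd, sqrt_eq_of_isDiagonalization hd]
  simp only [Sum.elim_comp_inl, Sum.elim_comp_inr, Matrix.zero_mulVec, add_zero, zero_add,
    dotProduct_orthogonal_diagonal_mulVec, normSq_modeCoeff hd.2.1]
  rw [← Finset.sum_add_distrib, Finset.mul_sum]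
  exact Finset.sum_congr rfl fun j _ => by ring

theorem dotProduct_corrMatrix_mul_spectralProj_mulVec {h : Matrix ι ι ℝ}
    (hd : IsDiagonalization h O γ) (f : ι → ℂ) (j : ι) :
    (tilde f ⬝ᵥ (corrMatrix h * spectralProj O j).mulVec (tilde f)) / 2 =
      Complex.normSq (modeCoeff O γ (fun x => (f x).re) (fun x => (f x).im) j) := by
  -- As a diagonal matrix the projection multiplies with `h^{±1/2}` entrywise in the eigenbasis.
  have hs : Matrix.single j j (1 : ℝ) = Matrix.diagonal (Pi.single j 1) := by
    ext x y
    by_cases hxy : x = y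
    · subst hxy; by_cases hx : j = x
      · subst hx; simp
      · simp [hx, Ne.symm hx]
    · rw [Matrix.diagonal_apply_ne _ hxy]
      simp only [Matrix.single_apply]
      exact if_neg fun hj => hxy (hj.1.symm.trans hj.2)
  have hsingle : ∀ d u : ι → ℝ, u ⬝ᵥ (O * Matrix.diagonal d * O.transpose *
      (O * Matrix.single j j 1 * O.transpose)).mulVec u = d j * (∑ x, O x j * u x) ^ 2 := by
    intro d u
    rw [hs, orthogonal_conj_mul hd.1, dotProduct_orthogonal_diagonal_mulVec]
    simp [Pi.single_apply]
  rw [corrMatrix, spectralProj, tilde, Matrix.fromBlocks_multiply, Matrix.fromBlocks_multiply,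
    Matrix.fromBlocks_multiply, Matrix.fromBlocks_mulVec, sumElim_dotProduct_sumElim,
    inv_sqrt_eq_of_isDiagonalization hd, sqrt_eq_of_isDiagonalization hd]
  simp only [Sum.elim_comp_inl, Sum.elim_comp_inr, Matrix.zero_mulVec, add_zero, zero_add,
    Matrix.mul_zero, Matrix.zero_mul, hsingle, normSq_modeCoeff hd.2.1]

theorem dotProduct_andersonMatrix_mulVec (G : SimpleGraph ι) [DecidableRel G.Adj] (lam : ℝ)
    (k q : ι → ℝ) :
    q ⬝ᵥ (andersonMatrix G lam k).mulVec q = ∑ x, k x * q x ^ 2 +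
      1 / 2 * ∑ x, ∑ y, if G.Adj x y then lam * (q x - q y) ^ 2 else 0 := by
  have h := G.lapMatrix_toLinearMap₂' ℝ q
  rw [Matrix.toLinearMap₂'_apply'] at h
  rw [andersonMatrix, Matrix.add_mulVec, dotProduct_add, Matrix.smul_mulVec, dotProduct_smul, h,
    add_comm]
  congr 1
  · simp only [dotProduct, Matrix.mulVec_diagonal]
    exact Finset.sum_congr rfl fun x _ => by ring
  · rw [smul_eq_mul, mul_div_assoc', div_eq_inv_mul, one_div, Finset.mul_sum]
    simp only [Finset.mul_sum, mul_ite, mul_zero]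

theorem posDef_andersonMatrix (G : SimpleGraph ι) [DecidableRel G.Adj] {lam : ℝ} (hlam : 0 ≤ lam)
    {k : ι → ℝ} (hk : ∀ x, 0 < k x) : (andersonMatrix G lam k).PosDef :=
  Matrix.PosDef.posSemidef_add ((G.posSemidef_lapMatrix ℝ).smul hlam)
    (Matrix.posDef_diagonal_iff.2 hk)

/-- The support excludes negative values and the density an atom at `0`, so almost surely all of the
finitely many `k x` are positive. -/
theorem ae_posDef_andersonMatrix (G : SimpleGraph ι) [DecidableRel G.Adj] {lam : ℝ}
    (hlam : 0 ≤ lam) {μ : Measure ℝ} {kmax : ℝ} (hμ : IsDisorderLaw μ kmax) :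
    ∀ᵐ k ∂(Measure.pi fun _ : ι => μ), (andersonMatrix G lam k).PosDef := by
  obtain ⟨hp, hsupp, ρ, C, -, -, hρ⟩ := hμ
  have hpos : ∀ᵐ t ∂μ, 0 < t := by
    have h0 : μ {0} = 0 := by
      rw [hρ]; exact withDensity_absolutelyContinuous _ _ (measure_singleton 0)
    have h1 : ∀ᵐ t ∂μ, t ∈ Set.Icc 0 kmax := hsupp
    have h2 : ∀ᵐ t ∂μ, t ≠ 0 := by simpa [ae_iff] using h0
    filter_upwards [h1, h2] with t ht ht0
    exact lt_of_le_of_ne ht.1 ht0.symm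
  have hall : ∀ᵐ k ∂(Measure.pi fun _ : ι => μ), ∀ x, 0 < k x :=
    ae_all_iff.2 fun x => (Measure.tendsto_eval_ae_ae (i := x)).eventually hpos
  filter_upwards [hall] with k hk
  exact posDef_andersonMatrix G hlam hk

end Matrices

/-! ### The Hamiltonian as a sum of independent oscillators -/

section Hamiltonian

variable {ι : Type} [Fintype ι] [DecidableEq ι] {O : Matrix ι ι ℝ} {γ : ι → ℝ}

theorem isCCR_modes (hO : O ∈ Matrix.orthogonalGroup ι ℝ) (hγ : ∀ j, 0 < γ j) :
    IsCCR (modeAnn O γ) (modeCre O γ) :=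
  ⟨modeAnn_mul_modeAnn hO, modeCre_mul_modeCre hO, modeAnn_mul_modeCre hO hγ⟩

theorem mode_oscillator (hO : O ∈ Matrix.orthogonalGroup ι ℝ) (hγ : ∀ j, 0 < γ j) (j : ι) :
    (γ j : ℂ) • ((2 : ℂ) • (modeCre O γ j * modeAnn O γ j) + 1) =
      ((γ j ^ 2 : ℝ) : ℂ) • lin (fun x => (O x j : ℂ)) 0 ^ 2 +
        lin 0 (fun x => (O x j : ℂ)) ^ 2 := by
  set Q := lin (fun x => (O x j : ℂ)) 0
  set P := lin 0 (fun x => (O x j : ℂ))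
  have hs0 : (Real.sqrt (γ j) : ℂ) ≠ 0 := by exact_mod_cast (Real.sqrt_pos.2 (hγ j)).ne'
  have h20 : (Real.sqrt 2 : ℂ) ≠ 0 := by exact_mod_cast (Real.sqrt_pos.2 two_pos).ne'
  have hg : (Real.sqrt (γ j) : ℂ) ^ 2 = γ j := by
    rw [← Complex.ofReal_pow, Real.sq_sqrt (hγ j).le]
  have h2 : (Real.sqrt 2 : ℂ) ^ 2 = 2 := by
    rw [← Complex.ofReal_pow, Real.sq_sqrt (by norm_num)]; norm_num
  have hQP : Q * P = P * Q + Complex.I • (1 : SOp ι) := by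
    rw [lin_mul_lin]
    congr 2
    have := orthogonal_sum_col hO j j
    simp only [if_true] at this
    simp only [Pi.zero_apply, zero_mul, sub_zero, ← Complex.ofReal_mul, ← Complex.ofReal_sum, this]
    simp
  set s := (Real.sqrt (γ j) : ℂ)
  have hb : modeAnn O γ j = (s / Real.sqrt 2) • Q + (Complex.I * (s⁻¹ / Real.sqrt 2)) • P := by
    rw [modeAnn_eq_lin, smul_lin, smul_lin, lin_add]
    congr 1 <;> ext x
    · simp [s]
    · simp [s]; ring
  have hc : modeCre O γ j = (s / Real.sqrt 2) • Q + (-Complex.I * (s⁻¹ / Real.sqrt 2)) • P := by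
    rw [modeCre_eq_lin, smul_lin, smul_lin, lin_add]
    congr 1 <;> ext x
    · simp [s]
    · simp [s]; ring
  -- The commutator `[Q, P] = I` leaves a scalar from the product `b_j^* b_j`, which cancels the
  -- added `1`.
  have key : (γ j : ℂ) • ((2 : ℂ) • (modeCre O γ j * modeAnn O γ j) + 1) =
      (γ j * 2 * (s / Real.sqrt 2) ^ 2) • (Q * Q) +
      (γ j * 2 * (s⁻¹ / Real.sqrt 2) ^ 2) • (P * P) +
      (γ j * (1 - 2 * ((s / Real.sqrt 2) * (s⁻¹ / Real.sqrt 2)))) • (1 : SOp ι) := by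
    rw [hb, hc]
    simp only [add_mul, mul_add, smul_mul_smul_comm, hQP]
    match_scalars
    · ring
    · ring
    · linear_combination (2 * γ j * (s / Real.sqrt 2) * (s⁻¹ / Real.sqrt 2) : ℂ) * Complex.I_sq
    · linear_combination (-(γ j) * 2 * (s⁻¹ / Real.sqrt 2) ^ 2 : ℂ) * Complex.I_sq
  have e1 : (γ j * 2 * (s / Real.sqrt 2) ^ 2 : ℂ) = ((γ j ^ 2 : ℝ) : ℂ) := by
    rw [div_pow, h2, hg]; push_cast; ring
  have e2 : (γ j * 2 * (s⁻¹ / Real.sqrt 2) ^ 2 : ℂ) = 1 := by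
    rw [div_pow, h2, inv_pow, hg]
    have : (γ j : ℂ) ≠ 0 := by exact_mod_cast (hγ j).ne'
    field_simp
  have e3 : (γ j * (1 - 2 * ((s / Real.sqrt 2) * (s⁻¹ / Real.sqrt 2))) : ℂ) = 0 := by
    have : 2 * ((s / Real.sqrt 2) * (s⁻¹ / Real.sqrt 2)) = 1 := by
      field_simp; rw [h2]
    rw [this]; ring
  rw [key, e1, e2, e3, one_smul, zero_smul, add_zero, pow_two Q, pow_two P]

theorem sum_modeMom_sq (hO : O ∈ Matrix.orthogonalGroup ι ℝ) :
    ∑ j, lin 0 (fun x => (O x j : ℂ)) ^ 2 = ∑ x, mom x ^ 2 := by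
  have h : ∀ j, lin 0 (fun x => (O x j : ℂ)) ^ 2 =
      ∑ x, ∑ y, ((O x j * O y j : ℝ) : ℂ) • (mom x * mom y) := fun j => by
    simp only [lin, Pi.zero_apply, zero_smul, zero_add, pow_two, Finset.sum_mul_sum,
      smul_mul_smul_comm, Complex.ofReal_mul]
  simp only [h]
  rw [Finset.sum_comm]
  refine Finset.sum_congr rfl fun x _ => ?_
  rw [Finset.sum_comm]
  simp only [← Finset.sum_smul, ← Complex.ofReal_sum, orthogonal_sum_row hO]
  simp [pow_two]

/-- The kinetic energy is invariant under the rotation `O`, and the potential is multiplication by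
the quadratic form of `h`, which is `∑ γ_j² (Oᵀq)_j²`. -/
theorem hamiltonian_eq_sum_modes {G : SimpleGraph ι} [DecidableRel G.Adj] {lam : ℝ} {k : ι → ℝ}
    (hd : IsDiagonalization (andersonMatrix G lam k) O γ) :
    hamiltonian G lam k =
      ∑ j, (γ j : ℂ) • ((2 : ℂ) • (modeCre O γ j * modeAnn O γ j) + 1) := by
  simp only [mode_oscillator hd.1 hd.2.1]
  rw [Finset.sum_add_distrib, sum_modeMom_sq hd.1, hamiltonian, Finset.sum_add_distrib, add_assoc,
    add_comm]
  congr 1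
  ext u q
  have hQ : ∀ j, (lin (fun x => (O x j : ℂ)) 0 ^ 2) u q = ((∑ x, O x j * q x) ^ 2 : ℝ) * u q := by
    intro j
    rw [pow_two, Module.End.mul_apply, lin_apply, lin_apply]
    simp
    ring
  have hP : ∀ x, (pos x ^ 2) u q = ((q x ^ 2 : ℝ) : ℂ) * u q := by
    intro x
    rw [pow_two, Module.End.mul_apply, pos_apply, pos_apply]
    push_cast; ring
  have hD : ∀ x y, (if G.Adj x y then (lam : ℂ) • (pos x - pos y) ^ 2 else 0 : SOp ι) u q =
      ((if G.Adj x y then lam * (q x - q y) ^ 2 else 0 : ℝ) : ℂ) * u q := by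
    intro x y
    split_ifs
    · rw [LinearMap.smul_apply, smul_apply, pow_two, Module.End.mul_apply, LinearMap.sub_apply,
        sub_apply, LinearMap.sub_apply, pos_apply, pos_apply, sub_apply, pos_apply, pos_apply]
      simp
      ring
    · simp
  have hquad := dotProduct_andersonMatrix_mulVec G lam k q
  rw [hd.2.2, dotProduct_orthogonal_diagonal_mulVec] at hquad
  simp only [LinearMap.add_apply, LinearMap.sum_apply, LinearMap.smul_apply, add_apply, sum_apply,
    smul_apply, hQ, hP, hD, smul_eq_mul, ← mul_assoc, ← Finset.sum_mul, ← Complex.ofReal_mul,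
    ← Complex.ofReal_sum, hquad]
  push_cast
  ring

end Hamiltonian

/-! ### Expectations as linear functionals -/

section Expectations

variable {ι : Type} [Fintype ι]

/-- The expectation in a Schwartz function as a linear functional on operators. -/
def expectL (ψ : 𝓢(Conf ι, ℂ)) : SOp ι →ₗ[ℂ] ℂ where
  toFun X := inner ℂ (embed ψ) (embed (X ψ))
  map_add' X Y := by rw [LinearMap.add_apply, map_add, inner_add_right]
  map_smul' c X := by
    rw [LinearMap.smul_apply, map_smul, inner_smul_right, RingHom.id_apply, smul_eq_mul]

theorem expectL_apply (ψ : 𝓢(Conf ι, ℂ)) (X : SOp ι) :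
    expectL ψ X = inner ℂ (embed ψ) (embed (X ψ)) := rfl

theorem expectL_one {ψ : 𝓢(Conf ι, ℂ)} (h : ‖embed ψ‖ = 1) : expectL ψ 1 = 1 := by
  rw [expectL_apply, Module.End.one_apply, inner_self_eq_norm_sq_to_K, h]
  simp

theorem expect_eq_expectL (ψ : 𝓢(Conf ι, ℂ)) (X : SOp ι) : expect ψ X = expectL ψ X := rfl

variable [DecidableEq ι]

theorem sum_stateCorr (ψ : 𝓢(Conf ι, ℂ)) (v : ι ⊕ ι → ℝ) :
    ∑ i, ∑ j, (v i : ℂ) * stateCorr ψ i j * (v j : ℂ) =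
      expectL ψ (phaseComb v * phaseComb v) := by
  simp only [phaseComb, Finset.sum_mul_sum, map_sum, smul_mul_smul_comm, map_smul, smul_eq_mul]
  refine Finset.sum_congr rfl fun i _ => Finset.sum_congr rfl fun j _ => ?_
  rw [stateCorr, expect_eq_expectL]
  ring

end Expectations

/-! ### Normalization and energies of the Fock states -/

section FockStates

variable {ι : Type} [Fintype ι] [DecidableEq ι] {O : Matrix ι ι ℝ} {γ : ι → ℝ}
  {ψ₀ : 𝓢(Conf ι, ℂ)}

theorem isFormalAdjoint_cre_prod (O : Matrix ι ι ℝ) (γ : ι → ℝ) (α : ι → ℕ) (l : List ι) :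
    IsFormalAdjoint (l.map fun j => modeCre O γ j ^ α j).prod
      (l.reverse.map fun j => modeAnn O γ j ^ α j).prod := by
  induction l with
  | nil => exact IsFormalAdjoint.one
  | cons j l ih =>
    simp only [List.reverse_cons, List.map_append, List.map_cons, List.map_nil, List.prod_append,
      List.prod_cons, List.prod_nil, mul_one]
    exact ((isFormalAdjoint_modeAnn O γ j).symm.pow _).mul ih

theorem IsVacuum.expectL_one (h : IsVacuum O γ ψ₀) : expectL ψ₀ 1 = 1 :=
  Oscillator.expectL_one h.1

theorem IsVacuum.expectL_mul_ann (h : IsVacuum O γ ψ₀) (j : ι) (X : SOp ι) :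
    expectL ψ₀ (X * modeAnn O γ j) = 0 := by
  rw [expectL_apply, Module.End.mul_apply, h.2 j]
  simp

theorem IsVacuum.expectL_cre_mul (h : IsVacuum O γ ψ₀) (j : ι) (X : SOp ι) :
    expectL ψ₀ (modeCre O γ j * X) = 0 := by
  rw [expectL_apply, Module.End.mul_apply, ← isFormalAdjoint_modeAnn O γ j, h.2 j]
  simp

/-- Diagonal Fock matrix elements of an operator that translates the modes. -/
theorem expectL_fockState (hO : O ∈ Matrix.orthogonalGroup ι ℝ) (hγ : ∀ j, 0 < γ j)
    (h : IsVacuum O γ ψ₀) (α : ι → ℕ) {T : SOp ι} {d e : ι → ℂ} {r : ι → ℝ}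
    (hd : ∀ j, modeAnn O γ j * T = T * modeAnn O γ j + d j • T)
    (he : ∀ j, T * modeCre O γ j = modeCre O γ j * T + e j • T)
    (hde : ∀ j, d j * e j = -(r j : ℂ)) :
    expectL (fockState O γ ψ₀ α) T = ((∏ j, laguerre (α j) (r j) : ℝ) : ℂ) * expectL ψ₀ T := by
  have key := map_ann_prod_mul_mul_cre_prod (isCCR_modes hO hγ) h.expectL_mul_ann
    h.expectL_cre_mul hde α Finset.univ.toList (Finset.nodup_toList _) T (fun j _ => hd j)
    (fun j _ => he j)
  set X := (Finset.univ.toList.map fun j => modeCre O γ j ^ α j).prod with hX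
  set N : ℝ := ∏ k, (Real.sqrt ((α k).factorial : ℝ))⁻¹ with hN
  have hf : fockState O γ ψ₀ α = (N : ℂ) • X ψ₀ := rfl
  have hN2 : N * N * ∏ j, ((α j).factorial : ℝ) = 1 := by
    rw [hN, ← Finset.prod_mul_distrib, ← Finset.prod_mul_distrib]
    refine Finset.prod_eq_one fun j _ => ?_
    have hpos : (0 : ℝ) < (α j).factorial := by exact_mod_cast Nat.factorial_pos _
    rw [← mul_inv, Real.mul_self_sqrt hpos.le, inv_mul_cancel₀ hpos.ne']
  have hN2' : (N : ℂ) * N * ∏ j, ((α j).factorial : ℂ) = 1 := by exact_mod_cast hN2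
  rw [Finset.prod_map_toList, Finset.prod_mul_distrib] at key
  -- The adjoint of the creation product is the reversed annihilation product, which turns the
  -- matrix element into a vacuum expectation.
  rw [expectL_apply, hf, map_smul, map_smul, map_smul, inner_smul_left, inner_smul_right,
    Complex.conj_ofReal, isFormalAdjoint_cre_prod]
  change (N : ℂ) * (N * expectL ψ₀ (_ * (T * X))) = _
  rw [← mul_assoc _ T X, key]
  push_cast
  linear_combination (∏ j, (laguerre (α j) (r j) : ℂ)) * expectL ψ₀ T * hN2'

/-- The identity translates no mode, and `L_n(0) = 1`. -/
theorem norm_embed_fockState (hO : O ∈ Matrix.orthogonalGroup ι ℝ) (hγ : ∀ j, 0 < γ j)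
    (h : IsVacuum O γ ψ₀) (α : ι → ℕ) : ‖embed (fockState O γ ψ₀ α)‖ = 1 := by
  have key := expectL_fockState hO hγ h α (T := 1) (d := 0) (e := 0) (r := 0)
    (by simp) (by simp) (by simp)
  simp only [Pi.zero_apply, laguerre_zero_right, Finset.prod_const_one, Complex.ofReal_one,
    one_mul, h.expectL_one] at key
  rw [expectL_apply, Module.End.one_apply, inner_self_eq_norm_sq_to_K] at key
  have : ‖embed (fockState O γ ψ₀ α)‖ ^ 2 = 1 :=
    Complex.ofReal_injective (by push_cast; exact key)
  exact (pow_eq_one_iff_of_nonneg (norm_nonneg _) two_ne_zero).1 this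

theorem number_fockState (hO : O ∈ Matrix.orthogonalGroup ι ℝ) (hγ : ∀ j, 0 < γ j)
    (h : IsVacuum O γ ψ₀) (α : ι → ℕ) (j : ι) :
    (modeCre O γ j * modeAnn O γ j) (fockState O γ ψ₀ α) = (α j : ℂ) • fockState O γ ψ₀ α := by
  have key := number_mul_cre_prod (isCCR_modes hO hγ) α j Finset.univ.toList
  rw [Finset.sum_map_toList, Finset.sum_ite_eq' Finset.univ j] at key
  simp only [Finset.mem_univ, if_true] at key
  have key' := congrArg (fun T : SOp ι => T ψ₀) key
  simp only [Module.End.mul_apply, LinearMap.add_apply, h.2 j, map_zero, zero_add,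
    Module.End.natCast_apply, map_nsmul] at key'
  rw [fockState, Module.End.mul_apply, map_smul, map_smul, key', smul_comm, Nat.cast_smul_eq_nsmul]

theorem hamiltonian_fockState {G : SimpleGraph ι} [DecidableRel G.Adj] {lam : ℝ} {k : ι → ℝ}
    (hd : IsDiagonalization (andersonMatrix G lam k) O γ) (h : IsVacuum O γ ψ₀) (α : ι → ℕ) :
    hamiltonian G lam k (fockState O γ ψ₀ α) =
      ((∑ j, γ j * (2 * (α j : ℝ) + 1) : ℝ) : ℂ) • fockState O γ ψ₀ α := by
  rw [hamiltonian_eq_sum_modes hd]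
  simp only [LinearMap.sum_apply, LinearMap.smul_apply, LinearMap.add_apply,
    number_fockState hd.1 hd.2.1 h, Module.End.one_apply]
  rw [Complex.ofReal_sum, Finset.sum_smul]
  refine Finset.sum_congr rfl fun j _ => ?_
  push_cast
  module

end FockStates

/-! ### Characteristic functions of the Fock states -/

section CharacteristicFunction

variable {ι : Type} [Fintype ι] [DecidableEq ι] {O : Matrix ι ι ℝ} {γ : ι → ℝ}
  {ψ₀ : 𝓢(Conf ι, ℂ)}

/-- The shift of `b_j` is `I t z_j` and that of `b_j^*` the same with `z_j` conjugated; at `t = 1`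
their product is `-|z_j|²`, whence the Laguerre argument. -/
theorem modeAnn_mul_weylS (u v : ι → ℝ) (t : ℝ) (j : ι) :
    modeAnn O γ j * weylS u v t =
      weylS u v t * modeAnn O γ j + (Complex.I * t * modeCoeff O γ u v j) • weylS u v t := by
  rw [modeAnn_eq_lin, weylS_mul_lin, add_assoc, ← add_smul, left_eq_add]
  convert! zero_smul ℂ _
  have e : ∀ x, ((Real.sqrt (γ j) / Real.sqrt 2 * O x j : ℝ) : ℂ) * v x -
      Complex.I * (((Real.sqrt (γ j))⁻¹ / Real.sqrt 2 * O x j : ℝ) : ℂ) * u x =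
      ((Real.sqrt (γ j) / Real.sqrt 2 : ℝ) : ℂ) * ((O x j * v x : ℝ) : ℂ) -
      Complex.I * (((Real.sqrt (γ j))⁻¹ / Real.sqrt 2 : ℝ) : ℂ) * ((O x j * u x : ℝ) : ℂ) := by
    intro x; push_cast; ring
  simp only [e, Finset.sum_sub_distrib, ← Finset.mul_sum, ← Complex.ofReal_sum]
  rw [modeCoeff]
  push_cast
  linear_combination (t * (Real.sqrt (γ j) / Real.sqrt 2) * ∑ x, (O x j * v x : ℂ)) * Complex.I_sq

theorem weylS_mul_modeCre (u v : ι → ℝ) (t : ℝ) (j : ι) :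
    weylS u v t * modeCre O γ j = modeCre O γ j * weylS u v t +
      (Complex.I * t * (starRingEnd ℂ) (modeCoeff O γ u v j)) • weylS u v t := by
  rw [modeCre_eq_lin, weylS_mul_lin]
  congr 2
  have e : ∀ x, ((Real.sqrt (γ j) / Real.sqrt 2 * O x j : ℝ) : ℂ) * v x -
      -Complex.I * (((Real.sqrt (γ j))⁻¹ / Real.sqrt 2 * O x j : ℝ) : ℂ) * u x =
      ((Real.sqrt (γ j) / Real.sqrt 2 : ℝ) : ℂ) * ((O x j * v x : ℝ) : ℂ) -
      -Complex.I * (((Real.sqrt (γ j))⁻¹ / Real.sqrt 2 : ℝ) : ℂ) * ((O x j * u x : ℝ) : ℂ) := by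
    intro x; push_cast; ring
  simp only [e, Finset.sum_sub_distrib, ← Finset.mul_sum, ← Complex.ofReal_sum]
  simp only [modeCoeff, map_add, map_mul, Complex.conj_ofReal, Complex.conj_I]
  push_cast
  linear_combination (t * (Real.sqrt (γ j) / Real.sqrt 2) * ∑ x, (O x j * v x : ℂ)) * Complex.I_sq

/-- Differentiating in `t` brings down the field. Its creation part dies on the left, and its
annihilation part passes to the right at the cost of `I t κ`. The result is `g' = -t κ g` with `g 0
= 1`. -/
theorem expectL_weylS_vacuum (hO : O ∈ Matrix.orthogonalGroup ι ℝ) (hγ : ∀ j, 0 < γ j)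
    (h : IsVacuum O γ ψ₀) (u v : ι → ℝ) :
    expectL ψ₀ (weylS u v 1) =
      ((Real.exp (-(∑ j, Complex.normSq (modeCoeff O γ u v j)) / 2) : ℝ) : ℂ) := by
  set κ : ℝ := ∑ j, Complex.normSq (modeCoeff O γ u v j) with hκ
  have hfield : ∀ t, expectL ψ₀ (realField u v * weylS u v t) =
      Complex.I * t * κ * expectL ψ₀ (weylS u v t) := by
    intro t
    rw [realField, lin_eq_sum_modes hO hγ, Finset.sum_mul, map_sum, hκ, Complex.ofReal_sum,
      Finset.mul_sum, Finset.sum_mul]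
    refine Finset.sum_congr rfl fun j _ => ?_
    rw [add_mul, smul_mul_assoc, smul_mul_assoc, map_add, map_smul, map_smul, h.expectL_cre_mul,
      modeAnn_mul_weylS, map_add, map_smul, h.expectL_mul_ann, Complex.normSq_eq_conj_mul_self]
    simp only [smul_eq_mul]
    ring
  have hg : ∀ t : ℝ, HasDerivAt (fun t : ℝ => expectL ψ₀ (weylS u v t))
      (-(t * κ) * expectL ψ₀ (weylS u v t)) t := by
    intro t
    have h1 := (hasDerivAt_const t (embed ψ₀)).inner ℂ (hasDerivAt_embed_weylS u v ψ₀ t)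
    rw [inner_zero_left, add_zero, inner_smul_right] at h1
    refine h1.congr_deriv ?_
    change Complex.I * expectL ψ₀ (realField u v * weylS u v t) = _
    rw [hfield]
    linear_combination (t * κ * expectL ψ₀ (weylS u v t)) * Complex.I_sq
  -- The integrating factor of this equation.
  have hE : ∀ t : ℝ, HasDerivAt (fun t : ℝ => ((Real.exp (κ / 2 * t ^ 2) : ℝ) : ℂ))
      ((t * κ) * ((Real.exp (κ / 2 * t ^ 2) : ℝ) : ℂ)) t := by
    intro t
    have h2 : HasDerivAt (fun t : ℝ => Real.exp (κ / 2 * t ^ 2))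
        (Real.exp (κ / 2 * t ^ 2) * (κ / 2 * (2 * t))) t := by
      simpa using! (((hasDerivAt_id t).pow 2).const_mul (κ / 2)).exp
    refine h2.ofReal_comp.congr_deriv ?_
    push_cast
    ring
  have hprod : ∀ t : ℝ, HasDerivAt (fun t : ℝ => ((Real.exp (κ / 2 * t ^ 2) : ℝ) : ℂ) *
      expectL ψ₀ (weylS u v t)) 0 t := fun t =>
    ((hE t).mul (hg t)).congr_deriv (by ring)
  have hc := is_const_of_deriv_eq_zero (fun t => (hprod t).differentiableAt)
    (fun t => (hprod t).deriv) 1 0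
  simp only [weylS_zero, h.expectL_one, one_pow, mul_one, ne_eq, OfNat.ofNat_ne_zero,
    not_false_eq_true, zero_pow, mul_zero, Real.exp_zero, Complex.ofReal_one] at hc
  rw [neg_div, Real.exp_neg, Complex.ofReal_inv]
  exact eq_inv_of_mul_eq_one_right hc

theorem unitaryExpect_fockState (hO : O ∈ Matrix.orthogonalGroup ι ℝ) (hγ : ∀ j, 0 < γ j)
    (h : IsVacuum O γ ψ₀) (α : ι → ℕ) {f : ι → ℂ} {W : Hilb ι ≃ₗᵢ[ℂ] Hilb ι} (hW : IsWeyl f W) :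
    unitaryExpect (fockState O γ ψ₀ α) W =
      ((Real.exp (-(∑ j, Complex.normSq
        (modeCoeff O γ (fun x => (f x).re) (fun x => (f x).im) j)) / 2) *
        ∏ j, laguerre (α j) (Complex.normSq
          (modeCoeff O γ (fun x => (f x).re) (fun x => (f x).im) j)) : ℝ) : ℂ) := by
  rw [unitaryExpect, isWeyl_apply_toHilb hW]
  set u := fun x => (f x).re
  set v := fun x => (f x).im
  change expectL (fockState O γ ψ₀ α) (weylS u v 1) = _
  rw [expectL_fockState hO hγ h α (modeAnn_mul_weylS u v 1) (weylS_mul_modeCre u v 1)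
    (r := fun j => Complex.normSq (modeCoeff O γ u v j)), expectL_weylS_vacuum hO hγ h, mul_comm,
    Complex.ofReal_mul]
  intro j
  rw [← Complex.mul_conj]
  push_cast
  linear_combination (modeCoeff O γ u v j * (starRingEnd ℂ) (modeCoeff O γ u v j)) * Complex.I_sq

end CharacteristicFunction

/-! ### Laguerre polynomials against exponentials -/

section LaguerreGrowth

/-- A Laguerre polynomial of positive degree does not decay exponentially. -/
theorem laguerre_ne_exp {n : ℕ} (hn : n ≠ 0) :
    ¬ ∀ x : ℝ, 0 ≤ x → laguerre n x = Real.exp (-(n * x)) := by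
  intro h
  set P : Polynomial ℝ := ∑ j ∈ Finset.range (n + 1),
    Polynomial.C ((-1) ^ j / (j.factorial : ℝ) * (n.choose j : ℝ)) * Polynomial.X ^ j with hP
  have hev : ∀ x, P.eval x = laguerre n x := fun x => by
    rw [hP, Polynomial.eval_finsetSum, laguerre]
    refine Finset.sum_congr rfl fun j _ => ?_
    simp only [Polynomial.eval_mul, Polynomial.eval_C, Polynomial.eval_pow, Polynomial.eval_X]
    ring
  have hcoeff : P.coeff n ≠ 0 := by
    rw [hP, Polynomial.finsetSum_coeff]
    simp only [Polynomial.coeff_C_mul_X_pow]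
    simp [Nat.factorial_ne_zero]
  have hdeg : 0 < P.degree :=
    lt_of_lt_of_le (by exact_mod_cast Nat.pos_of_ne_zero hn) (Polynomial.le_degree_of_ne_zero hcoeff)
  have ht := P.abs_tendsto_atTop hdeg
  -- A nonconstant polynomial exceeds `1` in modulus at some `x ≥ 0`, where the exponential is at
  -- most `1`.
  obtain ⟨x, hx0, hx⟩ := ((Filter.eventually_ge_atTop (0 : ℝ)).and
    (ht.eventually_gt_atTop 1)).exists
  rw [hev, h x hx0, abs_of_pos (Real.exp_pos _)] at hx
  have : Real.exp (-(n * x)) ≤ 1 := Real.exp_le_one_iff.2 (by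
    have : 0 ≤ (n : ℝ) * x := by positivity
    linarith)
  linarith

end LaguerreGrowth

/-! ### Only the vacuum is Gaussian -/

section GaussianStates

variable {ι : Type} [Fintype ι] [DecidableEq ι] {O : Matrix ι ι ℝ} {γ : ι → ℝ}
  {ψ₀ : 𝓢(Conf ι, ℂ)}

theorem fockState_zero (O : Matrix ι ι ℝ) (γ : ι → ℝ) (ψ₀ : 𝓢(Conf ι, ℂ)) :
    fockState O γ ψ₀ 0 = ψ₀ := by
  simp [fockState]

theorem phaseComb_eq_realField (v : ι ⊕ ι → ℝ) :
    phaseComb v = realField (fun x => v (.inl x)) (fun x => v (.inr x)) :=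
  phaseComb_eq_lin v

/-- The annihilation part of a field operator. -/
def annPart (O : Matrix ι ι ℝ) (γ u v : ι → ℝ) : SOp ι :=
  ∑ j, (starRingEnd ℂ) (modeCoeff O γ u v j) • modeAnn O γ j

theorem exists_annPart_mul_lin (O : Matrix ι ι ℝ) (γ u v : ι → ℝ) (c d : ι → ℂ) :
    ∃ s : ℂ, annPart O γ u v * lin c d = lin c d * annPart O γ u v + s • 1 := by
  have h : ∃ c' d', annPart O γ u v = lin c' d' := by
    simp only [annPart, modeAnn_eq_lin, smul_lin, sum_lin]
    exact ⟨_, _, rfl⟩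
  obtain ⟨c', d', h⟩ := h
  rw [h]
  exact ⟨_, lin_mul_lin c' d' c d⟩

theorem IsVacuum.expectL_mul_annPart (h : IsVacuum O γ ψ₀) (u v : ι → ℝ) (X : SOp ι) :
    expectL ψ₀ (X * annPart O γ u v) = 0 := by
  simp [annPart, Finset.mul_sum, h.expectL_mul_ann]

theorem IsVacuum.expectL_realField_mul (hO : O ∈ Matrix.orthogonalGroup ι ℝ)
    (hγ : ∀ j, 0 < γ j) (h : IsVacuum O γ ψ₀) (u v : ι → ℝ) (X : SOp ι) :
    expectL ψ₀ (realField u v * X) = expectL ψ₀ (annPart O γ u v * X) := by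
  rw [realField, lin_eq_sum_modes hO hγ, annPart]
  simp [Finset.sum_mul, Finset.sum_add_distrib, add_mul, h.expectL_cre_mul]

/-- The commutator is a scalar; taking vacuum expectations identifies it as the two-point function.
-/
theorem annPart_mul_lin (hO : O ∈ Matrix.orthogonalGroup ι ℝ)
    (hγ : ∀ j, 0 < γ j) (h : IsVacuum O γ ψ₀) (u v : ι → ℝ) (c d : ι → ℂ) :
    annPart O γ u v * lin c d = lin c d * annPart O γ u v +
      expectL ψ₀ (realField u v * lin c d) • 1 := by
  obtain ⟨s, hs⟩ := exists_annPart_mul_lin O γ u v c d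
  rw [h.expectL_realField_mul hO hγ, hs, map_add, h.expectL_mul_annPart, map_smul, h.expectL_one]
  simp

/-- The bosonic Wick theorem in the vacuum. -/
theorem IsVacuum.isGaussian (hO : O ∈ Matrix.orthogonalGroup ι ℝ)
    (hγ : ∀ j, 0 < γ j) (h : IsVacuum O γ ψ₀) : IsGaussian ψ₀ := by
  refine ⟨fun i => ?_, fun v l => ?_⟩
  · have hi : phaseOp i = phaseComb (Pi.single i (1 : ℝ)) := by
      simp [phaseComb, Pi.single_apply]
    have := h.expectL_realField_mul hO hγ (fun x => Pi.single (M := fun _ => ℝ) i 1 (.inl x))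
      (fun x => Pi.single (M := fun _ => ℝ) i 1 (.inr x)) 1
    rw [expect_eq_expectL, hi, phaseComb_eq_realField, ← mul_one (realField _ _), this, mul_one,
      ← one_mul (annPart _ _ _ _), h.expectL_mul_annPart]
  · simp only [expect_eq_expectL]
    set u := fun x => v (.inl x)
    set w := fun x => v (.inr x)
    have hv : phaseComb v = realField u w := phaseComb_eq_realField v
    have hcomm : ∀ x : ι ⊕ ι → ℝ, annPart O γ u w * phaseComb x =
        phaseComb x * annPart O γ u w + expectL ψ₀ (phaseComb v * phaseComb x) • 1 := fun x => by
      rw [hv, phaseComb_eq_realField x]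
      exact annPart_mul_lin hO hγ h u w _ _
    -- The annihilation part of the first factor moves to the right end, where it vanishes; each
    -- factor it passes becomes its partner in a pairing.
    conv_lhs => rw [hv, h.expectL_realField_mul hO hγ, mul_prod_eq_sum_eraseIdx phaseComb _ l hcomm]
    rw [map_add, h.expectL_mul_annPart, zero_add, map_sum]
    simp only [map_smul, smul_eq_mul]

/-- The phase space vector whose field operator is `b_j + b_j^*`. -/
def quadratureVec (O : Matrix ι ι ℝ) (γ : ι → ℝ) (j : ι) : ι → ℝ :=
  fun x => Real.sqrt 2 * Real.sqrt (γ j) * O x j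

theorem modeCoeff_quadratureVec (hO : O ∈ Matrix.orthogonalGroup ι ℝ) (hγ : ∀ j, 0 < γ j)
    (t : ℝ) (j k : ι) :
    modeCoeff O γ (fun x => t * quadratureVec O γ j x) (fun _ => 0) k =
      if k = j then (t : ℂ) else 0 := by
  have h1 : ∑ x, O x k * (t * quadratureVec O γ j x) =
      t * (Real.sqrt 2 * Real.sqrt (γ j)) * if k = j then 1 else 0 := by
    rw [← orthogonal_sum_col hO k j, Finset.mul_sum]
    exact Finset.sum_congr rfl fun x _ => by rw [quadratureVec]; ring
  rw [modeCoeff, h1]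
  by_cases hkj : k = j
  · subst hkj
    have h2 : Real.sqrt (γ k) ≠ 0 := (Real.sqrt_pos.2 (hγ k)).ne'
    have h3 : Real.sqrt 2 ≠ 0 := (Real.sqrt_pos.2 two_pos).ne'
    have : (Real.sqrt (γ k))⁻¹ / Real.sqrt 2 * (t * (Real.sqrt 2 * Real.sqrt (γ k)) * 1) = t := by
      field_simp
    rw [if_pos rfl, if_pos rfl, this]
    simp
  · simp [hkj]

theorem realField_quadratureVec (hO : O ∈ Matrix.orthogonalGroup ι ℝ) (hγ : ∀ j, 0 < γ j)
    (t : ℝ) (j : ι) :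
    realField (fun x => t * quadratureVec O γ j x) (fun _ => 0) =
      (t : ℂ) • (modeAnn O γ j + modeCre O γ j) := by
  rw [realField, lin_eq_sum_modes hO hγ]
  simp only [modeCoeff_quadratureVec hO hγ, apply_ite (starRingEnd ℂ), Complex.conj_ofReal,
    map_zero, ite_smul, zero_smul, Finset.sum_add_distrib, Finset.sum_ite_eq', Finset.mem_univ,
    if_true, smul_add]

theorem expectL_quadrature_moments (hO : O ∈ Matrix.orthogonalGroup ι ℝ) (hγ : ∀ j, 0 < γ j)
    (h : IsVacuum O γ ψ₀) (α : ι → ℕ) (j : ι) :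
    expectL (fockState O γ ψ₀ α)
        ((modeAnn O γ j + modeCre O γ j) * (modeAnn O γ j + modeCre O γ j)) = 2 * α j + 1 ∧
      expectL (fockState O γ ψ₀ α) ((modeAnn O γ j + modeCre O γ j) *
        ((modeAnn O γ j + modeCre O γ j) * ((modeAnn O γ j + modeCre O γ j) *
          (modeAnn O γ j + modeCre O γ j)))) = 6 * (α j : ℂ) ^ 2 + 6 * α j + 3 := by
  refine map_quadrature_moments (by simpa using modeAnn_mul_modeCre hO hγ j j)
    (expectL_one (norm_embed_fockState hO hγ h α)) (fun Y => ?_) (fun Y => ?_)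
  · have hadj : IsFormalAdjoint (modeCre O γ j * modeAnn O γ j)
        (modeCre O γ j * modeAnn O γ j) :=
      (isFormalAdjoint_modeAnn O γ j).symm.mul (isFormalAdjoint_modeAnn O γ j)
    rw [expectL_apply, Module.End.mul_apply, ← hadj, number_fockState hO hγ h, map_smul,
      inner_smul_left, Complex.conj_natCast]
    rfl
  · rw [expectL_apply, Module.End.mul_apply, number_fockState hO hγ h, map_smul, map_smul,
      inner_smul_right]
    rfl

/-- Wick's theorem for four copies of `b_j + b_j^*` demands `6n² + 6n + 3 = 3 (2n + 1)²` with `n = α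
j`, that is `6 n (n + 1) = 0`. -/
theorem isGaussian_fockState_iff (hO : O ∈ Matrix.orthogonalGroup ι ℝ) (hγ : ∀ j, 0 < γ j)
    (h : IsVacuum O γ ψ₀) (α : ι → ℕ) : IsGaussian (fockState O γ ψ₀ α) ↔ α = 0 := by
  refine ⟨fun hG => funext fun j => ?_, ?_⟩
  · set v : ι ⊕ ι → ℝ := Sum.elim (quadratureVec O γ j) (fun _ => 0)
    have hv : phaseComb v = modeAnn O γ j + modeCre O γ j := by
      have := realField_quadratureVec hO hγ 1 j
      simp only [one_mul, Complex.ofReal_one, one_smul] at this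
      rw [← this]
      exact phaseComb_eq_lin v
    obtain ⟨m2, m4⟩ := expectL_quadrature_moments hO hγ h α j
    have hw := hG.2 v [v, v, v]
    simp only [expect_eq_expectL, List.length_cons, List.length_nil, Fin.sum_univ_succ,
      Fin.sum_univ_zero, List.map_cons, List.map_nil, List.prod_cons, List.prod_nil, mul_one,
      List.get_eq_getElem, List.eraseIdx, Fin.val_zero, Fin.val_succ, List.getElem_cons_succ,
      List.getElem_cons_zero, hv, m2, m4] at hw
    have hw' : ((6 * (α j * (α j + 1)) : ℕ) : ℂ) = ((0 : ℕ) : ℂ) := by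
      push_cast
      linear_combination -hw
    have := Nat.cast_injective hw'
    simpa using this
  · rintro rfl
    rw [fockState_zero]
    exact h.isGaussian hO hγ

theorem IsVacuum.expectL_realField_sq (hO : O ∈ Matrix.orthogonalGroup ι ℝ)
    (hγ : ∀ j, 0 < γ j) (h : IsVacuum O γ ψ₀) (u v : ι → ℝ) :
    expectL ψ₀ (realField u v * realField u v) =
      ((∑ j, Complex.normSq (modeCoeff O γ u v j) : ℝ) : ℂ) := by
  rw [h.expectL_realField_mul hO hγ, annPart, Finset.sum_mul, map_sum, Complex.ofReal_sum]
  refine Finset.sum_congr rfl fun j _ => ?_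
  have hj : expectL ψ₀ (modeAnn O γ j * realField u v) = modeCoeff O γ u v j := by
    rw [realField, lin_eq_sum_modes hO hγ, Finset.mul_sum, map_sum]
    have : ∀ k, expectL ψ₀ (modeAnn O γ j * ((starRingEnd ℂ) (modeCoeff O γ u v k) • modeAnn O γ k +
        modeCoeff O γ u v k • modeCre O γ k)) = if j = k then modeCoeff O γ u v k else 0 := by
      intro k
      rw [mul_add, mul_smul_comm, mul_smul_comm, modeAnn_mul_modeCre hO hγ, map_add, map_smul,
        map_smul, h.expectL_mul_ann, map_add, h.expectL_cre_mul]
      split_ifs <;> simp [h.expectL_one]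
    simp [this]
  rw [smul_mul_assoc, map_smul, hj, smul_eq_mul, Complex.normSq_eq_conj_mul_self]

/-- Fields along the quadrature of mode `j` see only this mode. There the claim reads `e^{-x/2}
L_n(x) = e^{-x(2n+1)/2}` with `n = α j`, impossible for `n ≥ 1`. -/
theorem hasGaussianCharFun_fockState_iff (hO : O ∈ Matrix.orthogonalGroup ι ℝ)
    (hγ : ∀ j, 0 < γ j) (h : IsVacuum O γ ψ₀) (α : ι → ℕ) :
    HasGaussianCharFun (fockState O γ ψ₀ α) ↔ α = 0 := by
  refine ⟨fun hG => funext fun j => ?_, ?_⟩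
  · by_contra hj
    refine laguerre_ne_exp hj fun x hx => ?_
    -- With this scale `|z_j|² = x`, and the other mode coefficients vanish.
    set t := Real.sqrt x
    have ht : t * t = x := Real.mul_self_sqrt hx
    set f : ι → ℂ := fun x => ((t * quadratureVec O γ j x : ℝ) : ℂ)
    obtain ⟨W, hW, -⟩ := existsUnique_isWeyl f
    have key := hG f W hW
    have hfield : phaseComb (tilde f) = (t : ℂ) • (modeAnn O γ j + modeCre O γ j) := by
      rw [← realField_quadratureVec hO hγ]
      exact phaseComb_eq_lin _
    rw [unitaryExpect_fockState hO hγ h α hW, sum_stateCorr, hfield, smul_mul_smul_comm, map_smul,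
      (expectL_quadrature_moments hO hγ h α j).1] at key
    have hz : ∀ k, Complex.normSq (modeCoeff O γ (fun x => (f x).re) (fun x => (f x).im) k) =
        if k = j then x else 0 := by
      intro k
      simp only [f, Complex.ofReal_re, Complex.ofReal_im, modeCoeff_quadratureVec hO hγ]
      split_ifs
      · rw [Complex.normSq_ofReal, ht]
      · exact map_zero _
    simp only [hz, Finset.sum_ite_eq', Finset.mem_univ, if_true, smul_eq_mul,
      ← Complex.ofReal_mul, ht] at key
    have hprod : ∏ k, laguerre (α k) (if k = j then x else 0) = laguerre (α j) x := by
      rw [Finset.prod_eq_single j]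
      · simp
      · intro k _ hk; simp [hk, laguerre_zero_right]
      · simp
    have key' : Real.exp (-x / 2) * laguerre (α j) x =
        Real.exp (-(1 / 2) * (x * (2 * α j + 1))) := by
      rw [hprod] at key
      apply Complex.ofReal_injective
      rw [key]
      push_cast
      rfl
    have hsplit : Real.exp (-(1 / 2) * (x * (2 * α j + 1))) =
        Real.exp (-x / 2) * Real.exp (-(α j * x)) := by
      rw [← Real.exp_add]; congr 1; ring
    rw [hsplit] at key'
    exact mul_left_cancel₀ (Real.exp_pos _).ne' key'
  · rintro rfl
    intro f W hW
    rw [unitaryExpect_fockState hO hγ h 0 hW, sum_stateCorr, phaseComb_eq_realField,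
      fockState_zero, h.expectL_realField_sq hO hγ]
    simp only [Pi.zero_apply, laguerre_zero_left, Finset.prod_const_one, mul_one]
    rw [Complex.ofReal_exp]
    congr 1
    simp only [tilde, Sum.elim_inl, Sum.elim_inr]
    push_cast
    ring

end GaussianStates

end Oscillator

end

open Oscillator in
theorem theorem3p1 (d : ℕ) (hd : 1 ≤ d) (a b : ℤ) (hab : a < b) (lam : ℝ) (hlam : 0 < lam) :
    -- almost every realization of the i.i.d. spring constants gives a positive definite `h`
    (∀ (μ : MeasureTheory.Measure ℝ) (kmax : ℝ), IsDisorderLaw μ kmax →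
      ∀ᵐ k ∂(MeasureTheory.Measure.pi fun _ : Box d a b => μ),
        (andersonMatrix (boxGraph d a b) lam k).PosDef) ∧
    -- every Weyl operator exists and is unique
    (∀ f : Box d a b → ℂ, ∃! W, IsWeyl f W) ∧
    -- for every realization with positive definite `h` and every diagonalization of `h`
    ∀ k : Box d a b → ℝ, (andersonMatrix (boxGraph d a b) lam k).PosDef →
      ∀ (O : Matrix (Box d a b) (Box d a b) ℝ) (γ : Box d a b → ℝ),
        IsDiagonalization (andersonMatrix (boxGraph d a b) lam k) O γ →
        -- the vacuum exists and is unique up to a phase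
        (∃ ψ₀, IsVacuum O γ ψ₀) ∧
        (∀ ψ₀ ψ₁, IsVacuum O γ ψ₀ → IsVacuum O γ ψ₁ → ∃ c : ℂ, ‖c‖ = 1 ∧ ψ₁ = c • ψ₀) ∧
        ∀ ψ₀, IsVacuum O γ ψ₀ → ∀ α : Box d a b → ℕ,
          -- `ψ_α` is a normalized eigenvector of the Hamiltonian
          ‖toHilb (fockState O γ ψ₀ α)‖ = 1 ∧
          hamiltonian (boxGraph d a b) lam k (fockState O γ ψ₀ α) =
            ((∑ j, γ j * (2 * (α j : ℝ) + 1) : ℝ) : ℂ) • fockState O γ ψ₀ α ∧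
          -- the characteristic function of `ψ_α`
          (∀ f W, IsWeyl f W →
            unitaryExpect (fockState O γ ψ₀ α) W =
              ((Real.exp (-(1 / 4) *
                  (tilde f ⬝ᵥ
                    (corrMatrix (andersonMatrix (boxGraph d a b) lam k)).mulVec (tilde f))) *
                ∏ j, laguerre (α j)
                  ((tilde f ⬝ᵥ
                    (corrMatrix (andersonMatrix (boxGraph d a b) lam k) *
                      spectralProj O j).mulVec (tilde f)) / 2) : ℝ) : ℂ)) ∧
          -- only the ground state is Gaussian
          (IsGaussian (fockState O γ ψ₀ α) ↔ α = 0) ∧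
          (HasGaussianCharFun (fockState O γ ψ₀ α) ↔ α = 0) := by
  refine ⟨fun μ kmax hμ => ae_posDef_andersonMatrix _ hlam.le hμ, existsUnique_isWeyl,
    fun k _ O γ hdiag => ?_⟩
  obtain ⟨hO, hγ, -⟩ := id hdiag
  refine ⟨exists_isVacuum hO hγ, fun ψ₀ ψ₁ h₀ h₁ => isVacuum_unique hO hγ h₀ h₁,
    fun ψ₀ h α => ⟨norm_embed_fockState hO hγ h α, hamiltonian_fockState hdiag h α,
      fun f W hW => ?_, isGaussian_fockState_iff hO hγ h α,
      hasGaussianCharFun_fockState_iff hO hγ h α⟩⟩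
  rw [unitaryExpect_fockState hO hγ h α hW, dotProduct_corrMatrix_mulVec hdiag]
  simp only [dotProduct_corrMatrix_mul_spectralProj_mulVec hdiag]
  -- Only the exponents differ in form: `-κ/2` against `-(1/4) (2κ)`.
  congr 4
  ring
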